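/- Let $\alpha\in\mathbb R$ be irrational, and let $\mathbb A_{2\alpha}$ be the noncommutative torus, i.e. the universal unital $C^*$-algebra generated by two unitaries $U,V$ with $UV=e^{4\pi i\alpha}VU$. For $(m,n)\in\mathbb Z^2$ put $W(m,n)=e^{-2\pi i\alpha mn}U^mV^n$, and for finitely supported $f:\mathbb Z^2\to\mathbb C$ put $W(f)=\sum_{a\in\mathbb Z^2}f(a)W(a)$. Let $\mu$ be a Borel probability measure on the unit circle $\mathbb T$, with $\check\mu(m)=\int_{\mathbb T}z^m\,d\mu(z)$, and let $\omega_\mu$ be the unique state of $\mathbb A_{2\alpha}$ such that $$\omega_\mu(W(f))=\sum_{m\in\mathbb Z}\check\mu(m)f(m,0)$$ for all finitely supported $f$. Let $R$ be the rotation of $\mathbb T$ by the angle $2\pi\alpha$, and suppose that $\mu\circ R^{2n}$ (the measure $E\mapsto\mu(R^{2n}E)$) is absolutely continuous with respect to $\mu$ for every $n\in\mathbb Z$. Then the support $s(\omega_\mu)$ of $\omega_\mu$ in the bidual $\mathbb A_{2\alpha}^{**}$ (the smallest projection $p\in\mathbb A_{2\alpha}^{**}$ with $\omega_\mu(p)=1$)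 is central: $s(\omega_\mu)\in Z(\mathbb A_{2\alpha}^{**})$. Equivalently, the cyclic vector $\xi_{\omega_\mu}$ of the GNS representation $\pi_{\omega_\mu}$ is separating for the von Neumann algebra $\pi_{\omega_\mu}(\mathbb A_{2\alpha})''$. In particular, both of these properties hold. -/

import Mathlib

open scoped ENNReal ComplexOrder InnerProductSpace

noncomputable section

/-! ### The circle and its rotations -/

instance Circle.instMeasurableSpaceBorel : MeasurableSpace Circle := borel Circle

instance Circle.instBorelSpaceBorel : BorelSpace Circle := ⟨rfl⟩

/-- The rotation `R` of the unit circle by the angle `2πα`, as a homeomorphism; `R ^ n` is its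
`n`-fold iterate, for every integer `n`. -/
def circleRotation (α : ℝ) : Circle ≃ₜ Circle :=
  Homeomorph.mulLeft (Circle.exp (2 * Real.pi * α))

/-! ### The noncommutative torus -/

/-- Two unitaries `u, v` of a nonzero unital C⋆-algebra with `u v = e^{4πiα} v u`. -/
structure RotationPair (α : ℝ) : Type 1 where
  carrier : Type
  [cstar : CStarAlgebra carrier]
  [nontriv : Nontrivial carrier]
  u : unitary carrier
  v : unitary carrier
  comm : (u * v : carrier) =
    Complex.exp (4 * Real.pi * Complex.I * α) • ((v : carrier) * (u : carrier))

namespace RotationPair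

instance (α : ℝ) (i : RotationPair α) : CStarAlgebra i.carrier := i.cstar

instance (α : ℝ) (i : RotationPair α) : Nontrivial i.carrier := i.nontriv

end RotationPair

/-- The C⋆-algebra of all bounded families `(b_i)`, with `b_i` in the C⋆-algebra of the pair `i`,
where `i` runs over all pairs of unitaries satisfying the commutation relation. -/
abbrev RotationProduct (α : ℝ) : Type 1 := lp (fun i : RotationPair α => i.carrier) ∞

instance (α : ℝ) : CStarAlgebra (RotationProduct α) where

namespace NCTorus

/-- A family of unitaries, as an element of the product. -/
def prodElem (α : ℝ) (w : ∀ i : RotationPair α, unitary i.carrier) : RotationProduct α :=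
  ⟨fun i => (w i : i.carrier), memℓp_infty ⟨1, by
    rintro _ ⟨i, rfl⟩
    exact (CStarRing.norm_coe_unitary (w i)).le⟩⟩

theorem prodElem_mem (α : ℝ) (w : ∀ i : RotationPair α, unitary i.carrier) :
    prodElem α w ∈ unitary (RotationProduct α) := by
  rw [Unitary.mem_iff]
  constructor <;>
  · apply lp.ext
    funext i
    simp [lp.infty_coeFn_mul, prodElem]

/-- The closed unital star subalgebra generated by the two universal unitaries. -/
def subalgebra (α : ℝ) : StarSubalgebra ℂ (RotationProduct α) :=
  (StarAlgebra.adjoin ℂ {prodElem α (fun i => i.u), prodElem α (fun i => i.v)}).topologicalClosure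

end NCTorus

/-- The noncommutative torus `𝔸_{2α}`: the universal unital C⋆-algebra generated by two unitaries
`U, V` with `U V = e^{4πiα} V U`. It is realised as the C⋆-subalgebra generated by the pair
`((u_i), (v_i))` inside the bounded product over all such pairs `(u_i, v_i)` of unitaries in
C⋆-algebras; see `NCTorus.comm`, `NCTorus.closure_adjoin` and `NCTorus.existsUnique_lift`. Any C⋆-algebra
generated by two elements has at most continuum many elements, hence a copy in `Type`, so it is
enough to let the pairs live in C⋆-algebras in `Type`. -/
def NCTorus (α : ℝ) : Type 1 := NCTorus.subalgebra α

namespace NCTorus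

variable (α : ℝ)

instance : CStarAlgebra (NCTorus α) :=
  haveI : IsClosed (subalgebra α : Set (RotationProduct α)) :=
    StarSubalgebra.isClosed_topologicalClosure _
  inferInstanceAs (CStarAlgebra (subalgebra α))

/-- The canonical order of the C⋆-algebra `𝔸_{2α}`, whose positive elements are the `a⋆ a`. -/
instance : PartialOrder (NCTorus α) := CStarAlgebra.spectralOrder (NCTorus α)

instance : StarOrderedRing (NCTorus α) := CStarAlgebra.spectralOrderedRing (NCTorus α)

/-- The inclusion of `𝔸_{2α}` in the product. -/
def incl : NCTorus α →⋆ₐ[ℂ] RotationProduct α := (subalgebra α).subtype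

/-- The canonical unital star homomorphism of `𝔸_{2α}` sending `U, V` to a given pair. -/
def eval (i : RotationPair α) : NCTorus α →⋆ₐ[ℂ] i.carrier where
  toFun a := incl α a i
  map_one' := by simp [lp.infty_coeFn_one]
  map_mul' a b := by simp [lp.infty_coeFn_mul]
  map_zero' := by simp
  map_add' a b := by simp
  commutes' r := by
    rw [Algebra.algebraMap_eq_smul_one, Algebra.algebraMap_eq_smul_one, map_smul, map_one,
      lp.coeFn_smul, Pi.smul_apply, lp.infty_coeFn_one, Pi.one_apply]
  map_star' a := by rw [map_star, lp.star_apply]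

/-- The unitary generator `U` of `𝔸_{2α}`. -/
def U : unitary (NCTorus α) :=
  ⟨⟨prodElem α (fun i => i.u), StarSubalgebra.le_topologicalClosure _
      (StarAlgebra.subset_adjoin ℂ _ (by simp))⟩, by
    have h := Unitary.mem_iff.mp (prodElem_mem α (fun i => i.u))
    exact Unitary.mem_iff.mpr ⟨Subtype.ext h.1, Subtype.ext h.2⟩⟩

/-- The unitary generator `V` of `𝔸_{2α}`. -/
def V : unitary (NCTorus α) :=
  ⟨⟨prodElem α (fun i => i.v), StarSubalgebra.le_topologicalClosure _
      (StarAlgebra.subset_adjoin ℂ _ (by simp))⟩, by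
    have h := Unitary.mem_iff.mp (prodElem_mem α (fun i => i.v))
    exact Unitary.mem_iff.mpr ⟨Subtype.ext h.1, Subtype.ext h.2⟩⟩

@[simp] theorem eval_U (i : RotationPair α) : eval α i (U α) = i.u := rfl

@[simp] theorem eval_V (i : RotationPair α) : eval α i (V α) = i.v := rfl

variable {α}

theorem ext_eval {a b : NCTorus α} (h : ∀ i, eval α i a = eval α i b) : a = b :=
  Subtype.ext (lp.ext (funext h))

variable (α)

theorem comm : (U α * V α : NCTorus α) =
    Complex.exp (4 * Real.pi * Complex.I * α) • ((V α : NCTorus α) * (U α : NCTorus α)) := by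
  refine ext_eval fun i => ?_
  simpa using i.comm

theorem closure_adjoin :
    (StarAlgebra.adjoin ℂ {(U α : NCTorus α), (V α : NCTorus α)}).topologicalClosure = ⊤ := by
  rw [eq_top_iff]
  intro a _
  have hind : Topology.IsInducing (incl α) := Topology.IsInducing.subtypeVal
  have hmap := StarAlgHom.map_adjoin (incl α) {(U α : NCTorus α), (V α : NCTorus α)}
  rw [Set.image_pair] at hmap
  have h1 : incl α a ∈ closure ((StarAlgebra.adjoin ℂ
      {incl α (U α), incl α (V α)} : StarSubalgebra ℂ (RotationProduct α)) :
        Set (RotationProduct α)) := a.2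
  rw [← hmap, StarSubalgebra.coe_map] at h1
  change a ∈ closure _
  rw [hind.closure_eq_preimage_closure_image]
  exact h1

open scoped CStarAlgebra in
/-- The universal property of `𝔸_{2α}`. -/
theorem existsUnique_lift (B : Type) [CStarAlgebra B] (u v : unitary B)
    (h : (u * v : B) = Complex.exp (4 * Real.pi * Complex.I * α) • ((v : B) * (u : B))) :
    ∃! φ : NCTorus α →⋆ₐ[ℂ] B, φ (U α) = u ∧ φ (V α) = v := by
  refine existsUnique_of_exists_of_unique ?_ ?_
  · rcases subsingleton_or_nontrivial B with hB | hB
    · exact ⟨{ toFun := fun _ => 0, map_one' := Subsingleton.elim _ _,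
               map_mul' := fun _ _ => Subsingleton.elim _ _, map_zero' := rfl,
               map_add' := fun _ _ => Subsingleton.elim _ _,
               commutes' := fun _ => Subsingleton.elim _ _,
               map_star' := fun _ => Subsingleton.elim _ _ },
        Subsingleton.elim _ _, Subsingleton.elim _ _⟩
    · exact ⟨eval α ⟨B, u, v, h⟩, rfl, rfl⟩
  · rintro φ ψ ⟨h1, h2⟩ ⟨h3, h4⟩
    have hle : StarAlgebra.adjoin ℂ {(U α : NCTorus α), (V α : NCTorus α)} ≤
        StarAlgHom.equalizer φ ψ := by
      rw [StarAlgebra.adjoin_le_iff]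
      rintro x (rfl | rfl)
      · exact h1.trans h3.symm
      · exact h2.trans h4.symm
    have hcl := StarSubalgebra.topologicalClosure_minimal hle
      (isClosed_eq (map_continuous φ) (map_continuous ψ))
    rw [closure_adjoin] at hcl
    exact StarAlgHom.ext fun a => hcl (show a ∈ (⊤ : StarSubalgebra ℂ (NCTorus α)) from trivial)

/-! ### Weyl elements -/

/-- The Weyl unitary `W(m, n) = e^{-2πiα mn} U^m V^n`. -/
def weyl (a : ℤ × ℤ) : NCTorus α :=
  Complex.exp (-(2 * Real.pi * Complex.I * α * a.1 * a.2)) •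
    ((U α ^ a.1 * V α ^ a.2 : unitary (NCTorus α)) : NCTorus α)

/-- `W(f) = ∑_a f(a) W(a)` for a finitely supported `f`. -/
def weylSum (f : ℤ × ℤ →₀ ℂ) : NCTorus α := f.sum fun a c => c • weyl α a

theorem V_zpow_mul_U_zpow (m n : ℤ) : ∃ c : ℂ,
    ((V α ^ n * U α ^ m : unitary (NCTorus α)) : NCTorus α) =
      c • ((U α ^ m * V α ^ n : unitary (NCTorus α)) : NCTorus α) := by
  let q : ℂ := Complex.exp (4 * Real.pi * Complex.I * α)
  have hq : star q * q = 1 := by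
    have : ‖q‖ = 1 := by
      rw [show q = Complex.exp (((4 * Real.pi * α : ℝ) : ℂ) * Complex.I) by
        simp only [q]; congr 1; push_cast; ring]
      exact Complex.norm_exp_ofReal_mul_I _
    rw [RCLike.star_def, Complex.conj_mul', this]; simp
  let r : unitary ℂ := ⟨q, Unitary.mem_iff.mpr ⟨hq, by rw [mul_comm, hq]⟩⟩
  let am : ℂ →⋆* NCTorus α :=
    { toFun := algebraMap ℂ (NCTorus α), map_one' := map_one _, map_mul' := map_mul _,
      map_star' := fun z => algebraMap_star_comm z }
  let s : unitary (NCTorus α) := Unitary.map am r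
  have hs : ∀ (k : ℤ) (x : unitary (NCTorus α)), Commute (s ^ k) x := fun k x => by
    refine Commute.zpow_left ?_ k
    exact Subtype.ext (Algebra.commutes q (x : NCTorus α))
  have h0 : U α * V α = s * (V α * U α) := by
    apply Subtype.ext
    change (U α * V α : NCTorus α) = algebraMap ℂ _ q * ((V α : NCTorus α) * (U α : NCTorus α))
    rw [comm, Algebra.smul_def]
  have h1 : SemiconjBy (V α) (U α) (s ^ (-1 : ℤ) * U α) := by
    change V α * U α = s ^ (-1 : ℤ) * U α * V α
    rw [mul_assoc, h0, zpow_neg_one, inv_mul_cancel_left]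
  have h2 : SemiconjBy (U α ^ m) ((s ^ (-1 : ℤ)) ^ m * V α) (V α) := by
    have := h1.zpow_right m
    rw [(hs (-1) (U α)).mul_zpow] at this
    change U α ^ m * _ = _ * _
    rw [this.eq, ← mul_assoc, ← zpow_mul, ← (hs _ (U α ^ m)).eq]
  have h3 := h2.zpow_right n
  rw [← zpow_mul, (hs _ (V α)).mul_zpow, ← zpow_mul] at h3
  refine ⟨((r ^ (-1 * m * n) : unitary ℂ) : ℂ), ?_⟩
  rw [← h3.eq, ← mul_assoc, ← (hs _ (U α ^ m)).eq, mul_assoc, Algebra.smul_def, Submonoid.coe_mul]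
  congr 1
  rw [show s ^ (-1 * m * n) = Unitary.map am (r ^ (-1 * m * n)) from (map_zpow _ _ _).symm]
  rfl

/-- The elements `W(f)`, `f` finitely supported, are dense. -/
theorem closure_span_weyl :
    closure (Submodule.span ℂ (Set.range (weyl α)) : Set (NCTorus α)) = Set.univ := by
  have key : ∀ m n : ℤ, ((U α ^ m * V α ^ n : unitary (NCTorus α)) : NCTorus α) ∈
      Submodule.span ℂ (Set.range (weyl α)) := by
    intro m n
    have : weyl α (m, n) ∈ Submodule.span ℂ (Set.range (weyl α)) :=
      Submodule.subset_span ⟨_, rfl⟩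
    exact (Submodule.smul_mem_iff _ (Complex.exp_ne_zero _)).mp this
  have key2 : ∀ m n : ℤ, ((V α ^ n * U α ^ m : unitary (NCTorus α)) : NCTorus α) ∈
      Submodule.span ℂ (Set.range (weyl α)) := by
    intro m n
    obtain ⟨c, hc⟩ := V_zpow_mul_U_zpow α m n
    rw [hc]
    exact Submodule.smul_mem _ _ (key m n)
  have hmul : ∀ x ∈ Submodule.span ℂ (Set.range (weyl α)),
      ∀ y ∈ Submodule.span ℂ (Set.range (weyl α)),
        x * y ∈ Submodule.span ℂ (Set.range (weyl α)) := by
    intro x hx y hy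
    induction hx, hy using Submodule.span_induction₂ with
    | mem_mem x y hx hy =>
      obtain ⟨⟨m, n⟩, rfl⟩ := hx
      obtain ⟨⟨m', n'⟩, rfl⟩ := hy
      simp only [weyl, smul_mul_smul_comm]
      refine Submodule.smul_mem _ _ ?_
      obtain ⟨c, hc⟩ := V_zpow_mul_U_zpow α m' n
      have : ((U α ^ m * V α ^ n : unitary (NCTorus α)) : NCTorus α) *
          ((U α ^ m' * V α ^ n' : unitary (NCTorus α)) : NCTorus α) =
          c • ((U α ^ (m + m') * V α ^ (n + n') : unitary (NCTorus α)) : NCTorus α) := by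
        rw [zpow_add, zpow_add, ← Submonoid.coe_mul,
          show U α ^ m * V α ^ n * (U α ^ m' * V α ^ n') =
            U α ^ m * (V α ^ n * U α ^ m') * V α ^ n' by simp only [mul_assoc],
          Submonoid.coe_mul, Submonoid.coe_mul, hc]
        simp only [Submonoid.coe_mul, mul_smul_comm, smul_mul_assoc, mul_assoc]
      rw [this]
      exact Submodule.smul_mem _ _ (key _ _)
    | zero_left => simp
    | zero_right => simp
    | add_left x y z _ _ _ h1 h2 => rw [add_mul]; exact add_mem h1 h2
    | add_right x y z _ _ _ h1 h2 => rw [mul_add]; exact add_mem h1 h2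
    | smul_left r x y _ _ h => rw [smul_mul_assoc]; exact Submodule.smul_mem _ _ h
    | smul_right r x y _ _ h => rw [mul_smul_comm]; exact Submodule.smul_mem _ _ h
  have hstar : ∀ x ∈ Submodule.span ℂ (Set.range (weyl α)),
      star x ∈ Submodule.span ℂ (Set.range (weyl α)) := by
    intro x hx
    induction hx using Submodule.span_induction with
    | mem x hx =>
      obtain ⟨⟨m, n⟩, rfl⟩ := hx
      simp only [weyl, star_smul]
      refine Submodule.smul_mem _ _ ?_
      rw [← Unitary.coe_star, Unitary.star_eq_inv, mul_inv_rev, ← zpow_neg, ← zpow_neg]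
      exact key2 _ _
    | zero => simp
    | add x y _ _ h1 h2 => rw [star_add]; exact add_mem h1 h2
    | smul r x _ h => rw [star_smul]; exact Submodule.smul_mem _ _ h
  have h1 : ((1 : unitary (NCTorus α)) : NCTorus α) ∈
      Submodule.span ℂ (Set.range (weyl α)) := by simpa using key 0 0
  have hle : ∀ a ∈ StarAlgebra.adjoin ℂ {(U α : NCTorus α), (V α : NCTorus α)},
      a ∈ Submodule.span ℂ (Set.range (weyl α)) := by
    intro a ha
    induction ha using StarAlgebra.adjoin_induction with
    | mem x hx =>
      rcases hx with rfl | rfl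
      · simpa using key 1 0
      · simpa using key 0 1
    | algebraMap r =>
      rw [Algebra.algebraMap_eq_smul_one]
      exact Submodule.smul_mem _ _ h1
    | add x y _ _ h1 h2 => exact add_mem h1 h2
    | mul x y _ _ h1 h2 => exact hmul _ h1 _ h2
    | star x _ h => exact hstar _ h
  refine Set.eq_univ_of_univ_subset ?_
  have := closure_adjoin α
  intro a _
  have ha : a ∈ (StarAlgebra.adjoin ℂ
      {(U α : NCTorus α), (V α : NCTorus α)}).topologicalClosure := by
    rw [this]; trivial
  exact closure_mono hle ha

end NCTorus

/-! ### The states `ω_μ` -/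

/-- The Fourier anti-transform `μ̌(m) = ∫ z^m dμ(z)` of a measure on the circle. -/
def fourierAnti (μ : MeasureTheory.Measure Circle) (m : ℤ) : ℂ :=
  ∫ z : Circle, (z : ℂ) ^ m ∂μ

namespace NCTorus

/-- The Hilbert space `ℓ²(ℤ)`. -/
abbrev Ell2 : Type := lp (fun _ : ℤ => ℂ) 2

theorem memℓp_twist (c : ℤ → Circle) (e : ℤ ≃ ℤ) (g : Ell2) :
    Memℓp (fun n => (c n : ℂ) * g (e n)) 2 := by
  rw [memℓp_gen_iff (by simp)]
  have h := (memℓp_gen_iff (by simp)).mp (lp.memℓp g)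
  refine (e.summable_iff.mpr h).congr fun n => ?_
  rw [norm_mul, Circle.norm_coe, one_mul, Function.comp_apply]

/-- The isometry `g ↦ (n ↦ c_n g(e n))` of `ℓ²(ℤ)`. -/
def twistIsom (c : ℤ → Circle) (e : ℤ ≃ ℤ) : Ell2 →ₗᵢ[ℂ] Ell2 where
  toFun g := ⟨fun n => (c n : ℂ) * g (e n), memℓp_twist c e g⟩
  map_add' g h := by
    apply lp.ext; funext n
    exact mul_add _ _ _
  map_smul' r g := by
    apply lp.ext; funext n
    exact mul_left_comm _ _ _
  norm_map' g := by
    have h2 : 0 < (2 : ℝ≥0∞).toReal := by simp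
    have h3 : ∀ h : Ell2, ‖h‖ ^ (2 : ℝ≥0∞).toReal = ∑' n, ‖h n‖ ^ (2 : ℝ≥0∞).toReal :=
      fun h => lp.norm_rpow_eq_tsum h2 h
    refine (Real.rpow_left_inj (norm_nonneg _) (norm_nonneg _) h2.ne').mp ?_
    rw [h3 g]
    refine (h3 _).trans ?_
    rw [← e.tsum_eq (fun n => ‖g n‖ ^ (2 : ℝ≥0∞).toReal)]
    refine tsum_congr fun n => ?_
    change ‖(c n : ℂ) * g (e n)‖ ^ _ = _
    rw [norm_mul, Circle.norm_coe, one_mul]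

theorem twistIsom_apply (c : ℤ → Circle) (e : ℤ ≃ ℤ) (g : Ell2) (n : ℤ) :
    twistIsom c e g n = (c n : ℂ) * g (e n) := rfl

/-- The unitary operator `g ↦ (n ↦ c_n g(e n))` of `ℓ²(ℤ)`. -/
def twist (c : ℤ → Circle) (e : ℤ ≃ ℤ) : unitary (Ell2 →L[ℂ] Ell2) :=
  Unitary.linearIsometryEquiv.symm
    (LinearIsometryEquiv.ofSurjective (twistIsom c e) fun g =>
      ⟨twistIsom (fun n => (c (e.symm n))⁻¹) e.symm g, by
        apply lp.ext; funext n
        rw [twistIsom_apply, twistIsom_apply]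
        simp⟩)

theorem twist_apply (c : ℤ → Circle) (e : ℤ ≃ ℤ) (g : Ell2) (n : ℤ) :
    (twist c e : Ell2 →L[ℂ] Ell2) g n = (c n : ℂ) * g (e n) := rfl

theorem twist_mul (c d : ℤ → Circle) (e f : ℤ ≃ ℤ) :
    twist c e * twist d f = twist (fun n => c n * d (e n)) (e.trans f) := by
  apply Subtype.ext
  ext g n
  rw [Submonoid.coe_mul, mul_apply_eq_comp, twist_apply, twist_apply, twist_apply]
  simp [mul_assoc]

theorem twist_one : twist 1 (Equiv.refl ℤ) = 1 := by
  apply Subtype.ext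
  ext g n
  rw [twist_apply]
  simp

/-- The diagonal unitaries. -/
def diagHom : (ℤ → Circle) →* unitary (Ell2 →L[ℂ] Ell2) where
  toFun c := twist c (Equiv.refl ℤ)
  map_one' := twist_one
  map_mul' c d := by rw [twist_mul]; rfl

/-- The shifts. -/
def shiftHom : Multiplicative ℤ →* unitary (Ell2 →L[ℂ] Ell2) where
  toFun k := twist 1 (Equiv.subRight k.toAdd)
  map_one' := by
    rw [← twist_one]; congr 1; ext n; simp
  map_mul' k l := by
    rw [twist_mul]; congr 1
    · funext n; simp
    · ext n; simp [sub_sub]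

/-- For `z` in the circle, the pair `(U g)(n) = e^{4πiαn} z g(n)`, `(V g)(n) = g(n - 1)`. -/
def fiberPair (α : ℝ) (z : Circle) : RotationPair α where
  carrier := Ell2 →L[ℂ] Ell2
  cstar := inferInstance
  nontriv := ⟨0, 1, fun h => by
    have := congrArg (fun T : Ell2 →L[ℂ] Ell2 => T (lp.single 2 0 1) 0) h
    simp at this⟩
  u := diagHom fun n => Circle.exp (4 * Real.pi * α * n) * z
  v := shiftHom (Multiplicative.ofAdd 1)
  comm := by
    ext g n
    simp only [diagHom, shiftHom, MonoidHom.coe_mk, OneHom.coe_mk, mul_apply_eq_comp,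
      FunLike.coe_smul, Pi.smul_apply, lp.coeFn_smul, twist_apply, smul_eq_mul,
      Circle.coe_mul, Circle.coe_exp, Equiv.refl_apply, Equiv.subRight_apply, toAdd_ofAdd,
      Pi.one_apply, Circle.coe_one, one_mul]
    rw [← mul_assoc, ← mul_assoc, ← Complex.exp_add]
    congr 3
    push_cast
    ring

variable (α : ℝ)

/-- The canonical homomorphism attached to a pair, as a homomorphism of star monoids. -/
def evalMon (i : RotationPair α) : NCTorus α →⋆* i.carrier where
  toFun := eval α i
  map_one' := map_one _
  map_mul' := map_mul _
  map_star' := map_star _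

/-- The vector functional `a ↦ ⟨δ₀, π_z(a) δ₀⟩`. -/
def fiberState (z : Circle) (a : NCTorus α) : ℂ :=
  inner ℂ (lp.single 2 0 1 : Ell2)
    ((show Ell2 →L[ℂ] Ell2 from eval α (fiberPair α z) a) (lp.single 2 0 1))

theorem fiberState_eq (z : Circle) (a : NCTorus α) :
    fiberState α z a =
      (show Ell2 →L[ℂ] Ell2 from eval α (fiberPair α z) a) (lp.single 2 0 1) 0 := by
  rw [fiberState, lp.inner_single_left]
  simp

theorem fiberState_weyl (z : Circle) (a : ℤ × ℤ) :
    fiberState α z (weyl α a) = if a.2 = 0 then (z : ℂ) ^ a.1 else 0 := by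
  obtain ⟨m, n⟩ := a
  have hU : Unitary.map (evalMon α (fiberPair α z)) (U α) =
    (fiberPair α z).u := rfl
  have hV : Unitary.map (evalMon α (fiberPair α z)) (V α) =
    (fiberPair α z).v := rfl
  have h : eval α (fiberPair α z) ((U α ^ m * V α ^ n : unitary (NCTorus α)) : NCTorus α) =
      ((diagHom (fun n => Circle.exp (4 * Real.pi * α * n) * z) ^ m *
        shiftHom (Multiplicative.ofAdd 1) ^ n : unitary (Ell2 →L[ℂ] Ell2)) :
          Ell2 →L[ℂ] Ell2) := by
    change ((Unitary.map (evalMon α (fiberPair α z))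
      (U α ^ m * V α ^ n) : unitary (fiberPair α z).carrier) : (fiberPair α z).carrier) = _
    rw [map_mul, map_zpow, map_zpow, hU, hV]
    rfl
  rw [fiberState_eq, weyl, map_smul, h, ← map_zpow, ← map_zpow, ← ofAdd_zsmul]
  change Complex.exp _ * ((_ : Ell2 →L[ℂ] Ell2) _ : Ell2) 0 = _
  rw [Submonoid.coe_mul, mul_apply_eq_comp]
  simp only [diagHom, shiftHom, MonoidHom.coe_mk, OneHom.coe_mk, twist_apply]
  by_cases hn : n = 0
  · subst hn; simp
  · simp [hn]

theorem norm_fiberState_le (z : Circle) (a : NCTorus α) : ‖fiberState α z a‖ ≤ ‖a‖ := by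
  have h1 : ‖(lp.single 2 0 1 : Ell2)‖ = 1 := by
    rw [lp.norm_single (by simp)]; simp
  have h2 : ‖eval α (fiberPair α z) a‖ ≤ ‖a‖ := NonUnitalStarAlgHom.norm_apply_le _ _
  refine (norm_inner_le_norm _ _).trans ?_
  rw [h1, one_mul]
  refine (ContinuousLinearMap.le_opNorm _ _).trans ?_
  rw [h1, mul_one]
  exact h2

theorem fiberState_add (z : Circle) (a b : NCTorus α) :
    fiberState α z (a + b) = fiberState α z a + fiberState α z b := by
  simp only [fiberState_eq, map_add]; rfl

theorem fiberState_smul (z : Circle) (r : ℂ) (a : NCTorus α) :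
    fiberState α z (r • a) = r * fiberState α z a := by
  simp only [fiberState_eq, map_smul]; rfl

theorem fiberState_nonneg (z : Circle) (a : NCTorus α) (ha : 0 ≤ a) : 0 ≤ fiberState α z a := by
  obtain ⟨b, rfl⟩ := CStarAlgebra.nonneg_iff_eq_star_mul_self.mp ha
  have : fiberState α z (star b * b) =
      inner ℂ ((show Ell2 →L[ℂ] Ell2 from eval α (fiberPair α z) b) (lp.single 2 0 1))
        ((show Ell2 →L[ℂ] Ell2 from eval α (fiberPair α z) b) (lp.single 2 0 1)) := by
    rw [fiberState, map_mul, map_star]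
    exact ContinuousLinearMap.adjoint_inner_right
      (show Ell2 →L[ℂ] Ell2 from eval α (fiberPair α z) b) _ _
  rw [this, inner_self_eq_norm_sq_to_K]
  positivity

theorem continuous_fiberState (a : NCTorus α) : Continuous fun z => fiberState α z a := by
  have ha : a ∈ closure (Submodule.span ℂ (Set.range (weyl α)) : Set (NCTorus α)) := by
    rw [closure_span_weyl]; trivial
  have hspan : ∀ x ∈ Submodule.span ℂ (Set.range (weyl α)),
      Continuous fun z => fiberState α z x := by
    intro x hx
    induction hx using Submodule.span_induction with
    | mem x hx =>
      obtain ⟨⟨m, n⟩, rfl⟩ := hx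
      simp only [fiberState_weyl]
      by_cases hn : n = 0
      · simp only [hn, if_true]
        have h : Continuous fun z : Circle => ((z ^ m : Circle) : ℂ) :=
          (continuous_induced_dom : Continuous fun z : Circle => (z : ℂ)).comp (continuous_zpow m)
        simpa only [Circle.coe_zpow] using h
      · simp only [hn, if_false]; exact continuous_const
    | zero =>
      have : ∀ z, fiberState α z 0 = 0 := fun z => by
        rw [← zero_smul ℂ (0 : NCTorus α), fiberState_smul, zero_mul]
      simpa only [this] using continuous_const
    | add x y _ _ h1 h2 => simp only [fiberState_add]; exact h1.add h2
    | smul r x _ h => simp only [fiberState_smul]; exact continuous_const.mul h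
  obtain ⟨x, hx, hlim⟩ := mem_closure_iff_seq_limit.mp ha
  have hunif : TendstoUniformly (fun (k : ℕ) z => fiberState α z (x k))
      (fun z => fiberState α z a) Filter.atTop := by
    rw [Metric.tendstoUniformly_iff]
    intro ε hε
    filter_upwards [Metric.tendsto_atTop'.mp hlim ε hε |>.elim fun N hN =>
      Filter.eventually_gt_atTop N |>.mono hN] with k hk z
    rw [dist_eq_norm]
    have : fiberState α z a - fiberState α z (x k) = fiberState α z (a - x k) := by
      rw [sub_eq_add_neg a, fiberState_add, ← neg_one_smul ℂ (x k), fiberState_smul]; ring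
    rw [this]
    refine (norm_fiberState_le α z _).trans_lt ?_
    rwa [← dist_eq_norm, dist_comm]
  exact hunif.continuous (Filter.Eventually.of_forall fun k => hspan _ (hx k)).frequently

variable (μ : MeasureTheory.Measure Circle)

open scoped CStarAlgebra in
/-- The formula `ω(W(f)) = ∑_m μ̌(m) f(m, 0)` defines a unique positive functional. -/
theorem existsUnique_state [MeasureTheory.IsProbabilityMeasure μ] :
    ∃! ω : NCTorus α →ₚ[ℂ] ℂ, ∀ f : ℤ × ℤ →₀ ℂ,
      ω (weylSum α f) = ∑ᶠ m : ℤ, fourierAnti μ m * f (m, 0) := by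
  refine existsUnique_of_exists_of_unique ?_ ?_
  · have hint : ∀ a : NCTorus α, MeasureTheory.Integrable (fun z => fiberState α z a) μ := fun a =>
      (continuous_fiberState α a).integrable_of_hasCompactSupport
        (HasCompactSupport.of_compactSpace _)
    let ω : NCTorus α →ₚ[ℂ] ℂ := PositiveLinearMap.mk₀
      { toFun := fun a => ∫ z, fiberState α z a ∂μ
        map_add' := fun a b => by
          simp only [fiberState_add]
          exact MeasureTheory.integral_add (hint a) (hint b)
        map_smul' := fun r a => by
          simp only [fiberState_smul]
          exact MeasureTheory.integral_const_mul _ _ }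
      (fun a ha => MeasureTheory.integral_nonneg fun z => fiberState_nonneg α z a ha)
    have hω : ∀ a, ω (weyl α a) = if a.2 = 0 then fourierAnti μ a.1 else 0 := by
      intro a
      change ∫ z, fiberState α z (weyl α a) ∂μ = _
      simp only [fiberState_weyl]
      split_ifs
      · rfl
      · simp
    refine ⟨ω, fun f => ?_⟩
    induction f using Finsupp.induction_linear with
    | zero => simp [weylSum]
    | add f g hf hg =>
      have : weylSum α (f + g) = weylSum α f + weylSum α g :=
        Finsupp.sum_add_index' (by simp) (by simp [add_smul])
      rw [this, map_add, hf, hg, ← finsum_add_distrib]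
      · exact finsum_congr fun m => by simp [mul_add]
      · refine Set.Finite.subset (s := (f.support.image Prod.fst : Finset ℤ)) (Finset.finite_toSet _) ?_
        intro m hm
        have := right_ne_zero_of_mul hm
        simp only [Finset.coe_image, Set.mem_image, Finset.mem_coe, Finsupp.mem_support_iff]
        exact ⟨(m, 0), this, rfl⟩
      · refine Set.Finite.subset (s := (g.support.image Prod.fst : Finset ℤ)) (Finset.finite_toSet _) ?_
        intro m hm
        have := right_ne_zero_of_mul hm
        simp only [Finset.coe_image, Set.mem_image, Finset.mem_coe, Finsupp.mem_support_iff]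
        exact ⟨(m, 0), this, rfl⟩
    | single a c =>
      obtain ⟨m, n⟩ := a
      have : weylSum α (Finsupp.single (m, n) c) = c • weyl α (m, n) :=
        Finsupp.sum_single_index (by simp)
      rw [this, map_smul, hω, finsum_eq_single _ m]
      · by_cases hn : n = 0
        · subst hn; simp [mul_comm]
        · simp [hn]
      · intro k hk
        simp [hk.symm]
  · intro ω ω' h h'
    have hw : ∀ a, ω (weyl α a) = ω' (weyl α a) := by
      intro a
      have : weylSum α (Finsupp.single a 1) = weyl α a := by
        simp [weylSum]
      rw [← this, h, h']
    ext a
    have ha : a ∈ closure (Submodule.span ℂ (Set.range (weyl α)) : Set (NCTorus α)) := by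
      rw [closure_span_weyl]; trivial
    refine closure_minimal (t := {a | ω a = ω' a}) ?_
      (isClosed_eq (map_continuous ω) (map_continuous ω')) ha
    intro x hx
    induction hx using Submodule.span_induction with
    | mem x hx => obtain ⟨a, rfl⟩ := hx; exact hw a
    | zero => simp
    | add x y _ _ h1 h2 => simp only [Set.mem_ofPred_eq, map_add] at *; rw [h1, h2]
    | smul r x _ h => simp only [Set.mem_ofPred_eq, map_smul] at *; rw [h]

/-- The state `ω_μ` of `𝔸_{2α}`: the positive functional with
`ω_μ(W(f)) = ∑_m μ̌(m) f(m, 0)` for all finitely supported `f`. -/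
def state [MeasureTheory.IsProbabilityMeasure μ] : NCTorus α →ₚ[ℂ] ℂ :=
  (existsUnique_state α μ).choose

theorem state_weylSum [MeasureTheory.IsProbabilityMeasure μ] (f : ℤ × ℤ →₀ ℂ) :
    state α μ (weylSum α f) = ∑ᶠ m : ℤ, fourierAnti μ m * f (m, 0) :=
  (existsUnique_state α μ).choose_spec.1 f

end NCTorus

/-! ### The bidual of a C⋆-algebra -/

section Bidual

variable (A : Type*) [CStarAlgebra A]

/-- The bidual `A⋆⋆`. -/
abbrev Bidual : Type _ := StrongDual ℂ (StrongDual ℂ A)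

variable {A}

/-- The adjoint functional `φ⋆(a) = conj φ(a⋆)`. -/
def dualStar (φ : StrongDual ℂ A) : StrongDual ℂ A :=
  ((starL ℂ : ℂ ≃L⋆[ℂ] ℂ) : ℂ →L⋆[ℂ] ℂ).comp (φ.comp ((starL ℂ : A ≃L⋆[ℂ] A) : A →L⋆[ℂ] A))

@[simp] theorem dualStar_apply (φ : StrongDual ℂ A) (a : A) :
    dualStar φ a = star (φ (star a)) := rfl

theorem norm_dualStar_le (φ : StrongDual ℂ A) : ‖dualStar φ‖ ≤ ‖φ‖ :=
  ContinuousLinearMap.opNorm_le_bound _ (norm_nonneg _) fun a => by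
    simpa using φ.le_opNorm (star a)

namespace Bidual

/-- `φ ↦ (a ↦ φ · a)`, where `(φ · a)(b) = φ(a b)`. -/
def dualMul : StrongDual ℂ A →L[ℂ] A →L[ℂ] StrongDual ℂ A :=
  ((ContinuousLinearMap.compL ℂ A (A →L[ℂ] A) (StrongDual ℂ A)).flip
    (ContinuousLinearMap.mul ℂ A)).comp (ContinuousLinearMap.compL ℂ A A ℂ)

@[simp] theorem dualMul_apply (φ : StrongDual ℂ A) (a b : A) : dualMul φ a b = φ (a * b) := rfl

/-- The functional `G · φ` given by `(G · φ)(a) = G(φ · a)`. -/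
def act (G : Bidual A) : StrongDual ℂ A →L[ℂ] StrongDual ℂ A :=
  (ContinuousLinearMap.compL ℂ A (StrongDual ℂ A) ℂ G).comp dualMul

@[simp] theorem act_apply (G : Bidual A) (φ : StrongDual ℂ A) (a : A) :
    act G φ a = G (dualMul φ a) := rfl

/-- The (Arens) product of the bidual, `(F G)(φ) = F(G · φ)`. It extends the product of `A`. -/
instance : Mul (Bidual A) := ⟨fun F G => F.comp (act G)⟩

theorem mul_apply (F G : Bidual A) (φ : StrongDual ℂ A) : (F * G) φ = F (act G φ) := rfl

/-- The involution of the bidual, `F⋆(φ) = conj F(φ⋆)`. It extends the involution of `A`. -/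
instance : Star (Bidual A) := ⟨fun F =>
  LinearMap.mkContinuous
    { toFun := fun φ => star (F (dualStar φ))
      map_add' := fun φ ψ => by
        have : dualStar (φ + ψ) = dualStar φ + dualStar ψ := by ext; simp
        rw [this, map_add, star_add]
      map_smul' := fun r φ => by
        have : dualStar (r • φ) = star r • dualStar φ := by ext; simp
        rw [this, map_smul, star_smul, star_star]; rfl } ‖F‖ fun φ => by
      change ‖star (F (dualStar φ))‖ ≤ _
      rw [norm_star]
      exact (F.le_opNorm _).trans
        (mul_le_mul_of_nonneg_left (norm_dualStar_le φ) (norm_nonneg _))⟩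

theorem star_apply (F : Bidual A) (φ : StrongDual ℂ A) : (star F) φ = star (F (dualStar φ)) := rfl

/-- The canonical embedding of `A` in its bidual is multiplicative and star preserving. -/
theorem inclusion_mul (a b : A) :
    NormedSpace.inclusionInDoubleDual ℂ A (a * b) =
      (NormedSpace.inclusionInDoubleDual ℂ A a * NormedSpace.inclusionInDoubleDual ℂ A b :
        Bidual A) := rfl

theorem inclusion_star (a : A) :
    NormedSpace.inclusionInDoubleDual ℂ A (star a) =
      (star (NormedSpace.inclusionInDoubleDual ℂ A a : Bidual A) : Bidual A) := by
  ext φ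
  simp [star_apply]

variable [PartialOrder A] [StarOrderedRing A]

/-- A positive functional as an element of the dual space. -/
def ofPositive (ω : A →ₚ[ℂ] ℂ) : StrongDual ℂ A := ⟨ω.toLinearMap, map_continuous ω⟩

/-- `p` is the support `s(ω)` of the positive functional `ω` in the bidual: the smallest projection
`p` of `A⋆⋆` with `ω(p) = ω(1)`, where `ω` is evaluated on the bidual by duality. -/
structure IsSupport (ω : A →ₚ[ℂ] ℂ) (p : Bidual A) : Prop where
  isStarProjection : IsStarProjection p
  apply_eq : p (ofPositive ω) = ω 1
  least : ∀ q : Bidual A, IsStarProjection q → q (ofPositive ω) = ω 1 → p * q = p ∧ q * p = p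

theorem IsSupport.unique {ω : A →ₚ[ℂ] ℂ} {p q : Bidual A} (hp : IsSupport ω p)
    (hq : IsSupport ω q) : p = q :=
  (hp.least q hq.isStarProjection hq.apply_eq).1.symm.trans
    (hq.least p hp.isStarProjection hp.apply_eq).2

end Bidual

end Bidual

/-! ### The Gelfand-Naimark-Segal representation -/

section GNS

variable {A : Type*} [CStarAlgebra A] [PartialOrder A] [StarOrderedRing A] (ω : A →ₚ[ℂ] ℂ)

/-- The cyclic vector `ξ_ω` of the GNS representation, that is the class of the unit. -/
def gnsVector : ω.GNS := ((ω.toPreGNS 1 : ω.PreGNS) : ω.GNS)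

/-- The von Neumann algebra `π_ω(A)''` generated by the GNS representation. -/
def gnsBicommutant : Set (ω.GNS →L[ℂ] ω.GNS) :=
  Set.centralizer (Set.centralizer (Set.range ω.gnsStarAlgHom))

end GNS

end

/-! The state `ω_μ` is the average over `μ` of the vector states `fiberState α z` of representations
on ℓ²(ℤ) in which `U` is diagonal with entries e^{4πiαn}z and `V` is the shift
(`state_eq_integral`). Hence the closure of the vectors π(p(U))ξ, with p a trigonometric polynomial,
is a copy of L²(μ), in which s has the vector functional ∫ |s|² `fiberState` dμ
(`exists_vector_of_Lp`). The vector π(W(m,n))ξ has the functional obtained by averaging over `μ`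
rotated by 4παn (`state_weyl_conj`). By absolute continuity the rotated measure has a density |s|²,
so this functional also comes from a vector of the copy of L²(μ).

If two vectors define the same functional, some operator of the commutant carries one to the other,
so an element of the bicommutant killing the first kills the second (`apply_eq_zero_of_norm_eq`).
Let Tξ = 0. Then T kills each π(W(m,0))ξ, which has the same functional as ξ, hence the copy of
L²(μ), hence each π(W(m,n))ξ. These span a dense subspace, so T = 0 (`gnsVector_separating`).

For the support, the bidual acts in every representation (`bidualRep`), and the GNS representations
separate its points because every functional is a combination of positive ones (`Bidual.ext_gns`).
The central cover `centralProj ω` acts in each representation as the projection onto the part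
reached by intertwiners from the GNS space of `ω`; it is always central and fixes ξ. A projection q
with q(ω) = ω(1) fixes ξ; when ξ is separating, q acts as 1 on the GNS space, hence on everything
intertwined with it, so q dominates the central cover (`isSupport_centralProj`). -/

noncomputable section

/-! ### Intertwiners and the GNS representation -/

section Intertwiners

variable {A : Type*} [CStarAlgebra A]
  {H K : Type*} [NormedAddCommGroup H] [InnerProductSpace ℂ H] [CompleteSpace H]
  [NormedAddCommGroup K] [InnerProductSpace ℂ K] [CompleteSpace K]

/-- `C` intertwines the representations `π` and `ρ`. -/
def IsIntertwiner (π : A →⋆ₐ[ℂ] (H →L[ℂ] H)) (ρ : A →⋆ₐ[ℂ] (K →L[ℂ] K)) (C : H →L[ℂ] K) : Prop :=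
  ∀ a x, C (π a x) = ρ a (C x)

theorem inner_map_star_left (π : A →⋆ₐ[ℂ] (H →L[ℂ] H)) (a : A) (x y : H) :
    ⟪π (star a) x, y⟫_ℂ = ⟪x, π a y⟫_ℂ := by
  rw [map_star]
  exact ContinuousLinearMap.adjoint_inner_left (π a) y x

theorem inner_map_map (π : A →⋆ₐ[ℂ] (H →L[ℂ] H)) (a b : A) (x y : H) :
    ⟪π a x, π b y⟫_ℂ = ⟪x, π (star a * b) y⟫_ℂ := by
  rw [map_mul]
  change _ = ⟪x, π (star a) (π b y)⟫_ℂ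
  rw [← inner_map_star_left π (star a), star_star]

/-- Representations preserve stars, so the adjoint of the relation for `star a` is the relation for
`a`. -/
theorem IsIntertwiner.adjoint {π : A →⋆ₐ[ℂ] (H →L[ℂ] H)} {ρ : A →⋆ₐ[ℂ] (K →L[ℂ] K)}
    {C : H →L[ℂ] K} (hC : IsIntertwiner π ρ C) :
    IsIntertwiner ρ π (ContinuousLinearMap.adjoint C) := by
  intro a x
  refine ext_inner_right ℂ fun y => ?_
  rw [ContinuousLinearMap.adjoint_inner_left, ← star_star a, inner_map_star_left,
    inner_map_star_left, ContinuousLinearMap.adjoint_inner_left, hC]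

theorem IsIntertwiner.mem_centralizer {π : A →⋆ₐ[ℂ] (H →L[ℂ] H)} {C : H →L[ℂ] H}
    (hC : IsIntertwiner π π C) : C ∈ Set.centralizer (Set.range π) := by
  rintro _ ⟨a, rfl⟩
  ext x
  exact (hC a x).symm

/-- The matrix coefficient `a ↦ ⟨x, π(a) y⟩`. -/
def matrixCoeff (π : A →⋆ₐ[ℂ] (H →L[ℂ] H)) (x y : H) : StrongDual ℂ A :=
  LinearMap.mkContinuous
    { toFun := fun a => ⟪x, π a y⟫_ℂ
      map_add' := fun a b => by simp
      map_smul' := fun r a => by simp } (‖x‖ * ‖y‖) fun a => by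
    change ‖⟪x, π a y⟫_ℂ‖ ≤ _
    calc _ ≤ ‖x‖ * ‖π a y‖ := norm_inner_le_norm _ _
      _ ≤ ‖x‖ * (‖a‖ * ‖y‖) := by
        gcongr
        exact (ContinuousLinearMap.le_opNorm _ _).trans
          (by gcongr; exact NonUnitalStarAlgHom.norm_apply_le _ _)
      _ = _ := by ring

@[simp] theorem matrixCoeff_apply (π : A →⋆ₐ[ℂ] (H →L[ℂ] H)) (x y : H) (a : A) :
    matrixCoeff π x y a = ⟪x, π a y⟫_ℂ := rfl

theorem norm_matrixCoeff_le (π : A →⋆ₐ[ℂ] (H →L[ℂ] H)) (x y : H) :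
    ‖matrixCoeff π x y‖ ≤ ‖x‖ * ‖y‖ :=
  LinearMap.mkContinuous_norm_le _ (by positivity) _

/-- This is how coefficients of different representations are compared. -/
theorem IsIntertwiner.matrixCoeff_adjoint {π : A →⋆ₐ[ℂ] (H →L[ℂ] H)}
    {ρ : A →⋆ₐ[ℂ] (K →L[ℂ] K)} {C : H →L[ℂ] K} (hC : IsIntertwiner π ρ C) (x : K) (y : H) :
    matrixCoeff π (ContinuousLinearMap.adjoint C x) y = matrixCoeff ρ x (C y) := by
  ext a
  rw [matrixCoeff_apply, matrixCoeff_apply, ContinuousLinearMap.adjoint_inner_left, hC]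

/-! ### Vector functionals and cyclic vectors of GNS representations. -/

variable [PartialOrder A] [StarOrderedRing A]

/-- The positive functional `a ↦ ⟨x, π(a) x⟩`. -/
def vectorFunctional (π : A →⋆ₐ[ℂ] (H →L[ℂ] H)) (x : H) : A →ₚ[ℂ] ℂ :=
  PositiveLinearMap.mk₀ (matrixCoeff π x x).toLinearMap fun a ha => by
    obtain ⟨b, rfl⟩ := CStarAlgebra.nonneg_iff_eq_star_mul_self.mp ha
    change 0 ≤ ⟪x, π (star b * b) x⟫_ℂ
    rw [← inner_map_map, inner_self_eq_norm_sq_to_K]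
    positivity

theorem vectorFunctional_apply (π : A →⋆ₐ[ℂ] (H →L[ℂ] H)) (x : H) (a : A) :
    vectorFunctional π x a = ⟪x, π a x⟫_ℂ := rfl

theorem re_vectorFunctional_star_mul (π : A →⋆ₐ[ℂ] (H →L[ℂ] H)) (x : H) (a : A) :
    (vectorFunctional π x (star a * a)).re = ‖π a x‖ ^ 2 := by
  rw [vectorFunctional_apply, ← inner_map_map]
  exact (norm_sq_eq_re_inner (𝕜 := ℂ) (π a x)).symm

variable (ω : A →ₚ[ℂ] ℂ)

theorem gnsStarAlgHom_gnsVector (a : A) :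
    ω.gnsStarAlgHom a (gnsVector ω) = ((ω.toPreGNS a : ω.PreGNS) : ω.GNS) := by
  change ω.gnsNonUnitalStarAlgHom a ((ω.toPreGNS 1 : ω.PreGNS) : ω.GNS) = _
  rw [PositiveLinearMap.gnsNonUnitalStarAlgHom_apply_coe]
  simp

theorem inner_gnsVector (a b : A) :
    ⟪ω.gnsStarAlgHom a (gnsVector ω), ω.gnsStarAlgHom b (gnsVector ω)⟫_ℂ = ω (star a * b) := by
  rw [gnsStarAlgHom_gnsVector, gnsStarAlgHom_gnsVector, UniformSpace.Completion.inner_coe]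
  rfl

theorem matrixCoeff_gnsVector :
    matrixCoeff ω.gnsStarAlgHom (gnsVector ω) (gnsVector ω) = Bidual.ofPositive ω := by
  ext a
  have := inner_gnsVector ω 1 a
  simp only [map_one, star_one, one_mul] at this
  exact this

theorem norm_gnsVector_sq : ‖gnsVector ω‖ ^ 2 = (ω 1).re := by
  have := inner_gnsVector ω 1 1
  simp only [map_one, star_one, one_mul] at this
  rw [← this]
  exact norm_sq_eq_re_inner (𝕜 := ℂ) (gnsVector ω)

theorem norm_gns_apply_sq (a : A) :
    ‖ω.gnsStarAlgHom a (gnsVector ω)‖ ^ 2 = (ω (star a * a)).re := by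
  rw [← inner_gnsVector]
  exact norm_sq_eq_re_inner (𝕜 := ℂ) _

theorem denseRange_gns : DenseRange fun a => ω.gnsStarAlgHom a (gnsVector ω) := by
  simp only [gnsStarAlgHom_gnsVector]
  exact (UniformSpace.Completion.denseRange_coe : DenseRange fun a : ω.PreGNS => (a : ω.GNS))

variable {ω}

theorem gns_ext {K : Type*} [NormedAddCommGroup K] [InnerProductSpace ℂ K] {S T : ω.GNS →L[ℂ] K}
    (h : ∀ a, S (ω.gnsStarAlgHom a (gnsVector ω)) = T (ω.gnsStarAlgHom a (gnsVector ω))) :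
    S = T := by
  apply DFunLike.coe_injective
  exact (denseRange_gns ω).equalizer S.continuous T.continuous (funext h)

/-- A vector of a representation whose functional is dominated by `ω` is the image of the cyclic
vector under an intertwiner. -/
theorem exists_intertwiner (π : A →⋆ₐ[ℂ] (K →L[ℂ] K)) (y : K)
    (hy : ∀ a, ‖π a y‖ ^ 2 ≤ (ω (star a * a)).re) :
    ∃ C : ω.GNS →L[ℂ] K, IsIntertwiner ω.gnsStarAlgHom π C ∧ C (gnsVector ω) = y := by
  -- By `hy` the map a ↦ π(a)y is a contraction for the GNS seminorm, so it extends to the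
  -- completion.
  let f : ω.PreGNS →L[ℂ] K := LinearMap.mkContinuous
    { toFun := fun a => π (ω.ofPreGNS a) y
      map_add' := fun a b => by simp
      map_smul' := fun r a => by simp } 1 fun a => by
    rw [one_mul, ← sq_le_sq₀ (norm_nonneg _) (norm_nonneg _), PositiveLinearMap.preGNS_norm_def,
      Real.sq_sqrt]
    · exact hy _
    · exact (Complex.le_def.mp (ω.map_nonneg (star_mul_self_nonneg _))).1
  let C : ω.GNS →L[ℂ] K := f.extend UniformSpace.Completion.toComplL
  have hC : ∀ a, C (ω.gnsStarAlgHom a (gnsVector ω)) = π a y := by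
    intro a
    rw [gnsStarAlgHom_gnsVector]
    exact f.extend_eq UniformSpace.Completion.denseRange_coe
      (UniformSpace.Completion.isUniformInducing_coe _) (ω.toPreGNS a)
  refine ⟨C, fun a => ?_, ?_⟩
  · have : C ∘L ω.gnsStarAlgHom a = π a ∘L C := by
      apply gns_ext
      intro b
      change C ((ω.gnsStarAlgHom a * ω.gnsStarAlgHom b) (gnsVector ω)) = π a (C _)
      rw [← map_mul, hC, hC, map_mul]
      rfl
    exact fun x => DFunLike.congr_fun this x
  · simpa using hC 1

/-- If two vectors define the same functional and `T` in the bicommutant kills one of them, then it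
kills the other. -/
theorem apply_eq_zero_of_norm_eq (π : A →⋆ₐ[ℂ] (K →L[ℂ] K)) {x y : K}
    (hxy : ∀ a, ‖π a y‖ = ‖π a x‖) {T : K →L[ℂ] K}
    (hT : T ∈ Set.centralizer (Set.centralizer (Set.range π))) (hx : T x = 0) : T y = 0 := by
  obtain ⟨C, hC, hCx⟩ := exists_intertwiner (ω := vectorFunctional π x) π x fun a => by
    rw [re_vectorFunctional_star_mul]
  obtain ⟨D, hD, hDy⟩ := exists_intertwiner (ω := vectorFunctional π x) π y fun a => by
    rw [re_vectorFunctional_star_mul, hxy]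
  -- C is isometric, so its adjoint sends x back to the cyclic vector. Thus D C⋆ lies in the
  -- commutant and carries x to y.
  have h1 : ContinuousLinearMap.adjoint C x = gnsVector (vectorFunctional π x) := by
    rw [← sub_eq_zero]
    refine (denseRange_gns (vectorFunctional π x)).eq_zero_of_inner_right ℂ ?_
    intro a
    rw [inner_sub_right, ContinuousLinearMap.adjoint_inner_right, hC, hCx, sub_eq_zero]
    have := inner_gnsVector (vectorFunctional π x) a 1
    rw [map_one, mul_one] at this
    refine Eq.trans ?_ this.symm
    rw [vectorFunctional_apply, ← inner_map_star_left, star_star]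
  have h2 : (D ∘L ContinuousLinearMap.adjoint C) x = y := by
    rw [ContinuousLinearMap.comp_apply, h1, hDy]
  have h3 : IsIntertwiner π π (D ∘L ContinuousLinearMap.adjoint C) := fun a z => by
    simp only [ContinuousLinearMap.comp_apply]
    rw [hC.adjoint, hD]
  have h4 := hT _ h3.mem_centralizer
  calc T y = (T * (D ∘L ContinuousLinearMap.adjoint C)) x := by
        rw [← h2]; rfl
    _ = (D ∘L ContinuousLinearMap.adjoint C) (T x) := by rw [← h4]; rfl
    _ = 0 := by rw [hx, map_zero]

end Intertwiners

/-! ### Extension of representations to the bidual -/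

section BidualRep

variable {A : Type*} [CStarAlgebra A]
  {H K : Type*} [NormedAddCommGroup H] [InnerProductSpace ℂ H] [CompleteSpace H]
  [NormedAddCommGroup K] [InnerProductSpace ℂ K] [CompleteSpace K]

/-- The sesquilinear form `(x, y) ↦ F(⟨x, π(·) y⟩)`. -/
def bidualForm (π : A →⋆ₐ[ℂ] (H →L[ℂ] H)) (F : Bidual A) : H →L⋆[ℂ] H →L[ℂ] ℂ :=
  LinearMap.mkContinuous₂
    (LinearMap.mk₂'ₛₗ (starRingEnd ℂ) (RingHom.id ℂ) (fun x y => F (matrixCoeff π x y))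
      (fun x x' y => by
        rw [← map_add]; congr 1; ext a; simp)
      (fun r x y => by
        rw [← map_smul]; congr 1; ext a; simp [mul_comm])
      (fun x y y' => by
        rw [← map_add]; congr 1; ext a; simp)
      (fun r x y => by
        rw [RingHom.id_apply, ← map_smul]; congr 1; ext a; simp)) ‖F‖
    fun x y => by
      rw [mul_assoc]
      exact (F.le_opNorm _).trans (by gcongr; exact norm_matrixCoeff_le π x y)

/-- The extension of a representation of `A` to the bidual:
`⟨x, bidualRep π F y⟩ = F(⟨x, π(·) y⟩)`. -/
def bidualRep (π : A →⋆ₐ[ℂ] (H →L[ℂ] H)) (F : Bidual A) : H →L[ℂ] H :=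
  ContinuousLinearMap.adjoint (InnerProductSpace.continuousLinearMapOfBilin (bidualForm π F))

theorem inner_bidualRep (π : A →⋆ₐ[ℂ] (H →L[ℂ] H)) (F : Bidual A) (x y : H) :
    ⟪x, bidualRep π F y⟫_ℂ = F (matrixCoeff π x y) := by
  rw [bidualRep, ContinuousLinearMap.adjoint_inner_right,
    InnerProductSpace.continuousLinearMapOfBilin_apply]
  rfl

/-- Translating a coefficient by `a` replaces x by π(a⋆)x. This identity turns the Arens product
into composition of operators. -/
theorem act_matrixCoeff (π : A →⋆ₐ[ℂ] (H →L[ℂ] H)) (F : Bidual A) (x y : H) :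
    Bidual.act F (matrixCoeff π x y) = matrixCoeff π x (bidualRep π F y) := by
  ext a
  rw [Bidual.act_apply, matrixCoeff_apply, ← star_star a, ← inner_map_star_left, inner_bidualRep,
    star_star]
  congr 1
  ext b
  rw [Bidual.dualMul_apply, matrixCoeff_apply, matrixCoeff_apply, inner_map_star_left, map_mul]
  rfl

theorem bidualRep_mul (π : A →⋆ₐ[ℂ] (H →L[ℂ] H)) (F G : Bidual A) :
    bidualRep π (F * G) = bidualRep π F * bidualRep π G := by
  ext y
  refine ext_inner_left ℂ fun x => ?_
  rw [inner_bidualRep, Bidual.mul_apply, act_matrixCoeff, ← inner_bidualRep]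
  rfl

theorem bidualRep_star (π : A →⋆ₐ[ℂ] (H →L[ℂ] H)) (F : Bidual A) :
    bidualRep π (star F) = ContinuousLinearMap.adjoint (bidualRep π F) := by
  ext y
  refine ext_inner_left ℂ fun x => ?_
  rw [inner_bidualRep, Bidual.star_apply, ContinuousLinearMap.adjoint_inner_right,
    ← inner_conj_symm, inner_bidualRep]
  change star _ = star _
  congr 2
  ext a
  rw [dualStar_apply, matrixCoeff_apply, matrixCoeff_apply, ← inner_map_star_left, star_star]
  exact inner_conj_symm _ _

/-- The extension is defined through coefficients alone, and C moves across coefficients. Applied to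
the commutant, this puts the extension in the bicommutant. -/
theorem IsIntertwiner.bidualRep_apply {π : A →⋆ₐ[ℂ] (H →L[ℂ] H)} {ρ : A →⋆ₐ[ℂ] (K →L[ℂ] K)}
    {C : H →L[ℂ] K} (hC : IsIntertwiner π ρ C) (F : Bidual A) (x : H) :
    C (bidualRep π F x) = bidualRep ρ F (C x) := by
  refine ext_inner_left ℂ fun y => ?_
  rw [inner_bidualRep, ← ContinuousLinearMap.adjoint_inner_left, inner_bidualRep,
    hC.matrixCoeff_adjoint]

theorem isIntertwiner_of_mem_centralizer {π : A →⋆ₐ[ℂ] (H →L[ℂ] H)} {C : H →L[ℂ] H}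
    (hC : C ∈ Set.centralizer (Set.range π)) : IsIntertwiner π π C := fun a x =>
  (DFunLike.congr_fun (hC _ ⟨a, rfl⟩) x).symm

theorem bidualRep_mem_bicommutant (π : A →⋆ₐ[ℂ] (H →L[ℂ] H)) (F : Bidual A) :
    bidualRep π F ∈ Set.centralizer (Set.centralizer (Set.range π)) := by
  intro C hC
  ext x
  exact (isIntertwiner_of_mem_centralizer hC).bidualRep_apply F x

end BidualRep

/-! ### Decomposition of functionals into positive ones -/

section Jordan

variable {A : Type*} [CStarAlgebra A] [PartialOrder A] [StarOrderedRing A]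

/-- The infimum of `‖Re x + y + w‖ - Re ψ(w)` over positive `y, w`. -/
def jordanGauge (ψ : StrongDual ℂ A) (x : A) : ℝ :=
  ⨅ p : {p : A × A // 0 ≤ p.1 ∧ 0 ≤ p.2}, ‖(realPart x : A) + p.1.1 + p.1.2‖ * ‖ψ‖ - (ψ p.1.2).re

/-- From 0 ≤ w ≤ y + w follows ‖w‖ ≤ ‖y + w‖. The bound keeps the infimum finite and makes the gauge
nonnegative at 0, as Hahn–Banach requires. -/
theorem jordanGauge_bound (ψ : StrongDual ℂ A) (x : A) {y w : A} (hy : 0 ≤ y) (hw : 0 ≤ w) :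
    -(‖(realPart x : A)‖ * ‖ψ‖) ≤ ‖(realPart x : A) + y + w‖ * ‖ψ‖ - (ψ w).re := by
  have h1 : ‖w‖ ≤ ‖y + w‖ := CStarAlgebra.norm_le_norm_of_nonneg_of_le hw (by simpa using hy)
  have h2 : ‖y + w‖ ≤ ‖(realPart x : A) + y + w‖ + ‖(realPart x : A)‖ := by
    have : y + w = ((realPart x : A) + y + w) - (realPart x : A) := by abel
    conv_lhs => rw [this]
    exact norm_sub_le _ _
  have h3 : (ψ w).re ≤ ‖ψ‖ * ‖w‖ := (Complex.re_le_norm _).trans (ψ.le_opNorm _)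
  nlinarith [norm_nonneg ψ]

theorem bddBelow_jordanGauge (ψ : StrongDual ℂ A) (x : A) :
    BddBelow (Set.range fun p : {p : A × A // 0 ≤ p.1 ∧ 0 ≤ p.2} =>
      ‖(realPart x : A) + p.1.1 + p.1.2‖ * ‖ψ‖ - (ψ p.1.2).re) :=
  ⟨_, by rintro _ ⟨p, rfl⟩; exact jordanGauge_bound ψ x p.2.1 p.2.2⟩

theorem jordanGauge_le (ψ : StrongDual ℂ A) (x : A) {y w : A} (hy : 0 ≤ y) (hw : 0 ≤ w) :
    jordanGauge ψ x ≤ ‖(realPart x : A) + y + w‖ * ‖ψ‖ - (ψ w).re :=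
  ciInf_le (bddBelow_jordanGauge ψ x) ⟨(y, w), hy, hw⟩

theorem jordanGauge_add_le (ψ : StrongDual ℂ A) (x x' : A) :
    jordanGauge ψ (x + x') ≤ jordanGauge ψ x + jordanGauge ψ x' := by
  have : Nonempty {p : A × A // 0 ≤ p.1 ∧ 0 ≤ p.2} := ⟨⟨0, le_rfl, le_rfl⟩⟩
  refine le_ciInf_add_ciInf fun p q => ?_
  refine (jordanGauge_le ψ _ (add_nonneg p.2.1 q.2.1) (add_nonneg p.2.2 q.2.2)).trans ?_
  rw [map_add, map_add, Complex.add_re, AddSubgroup.coe_add,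
    show (realPart x : A) + (realPart x' : A) + (p.1.1 + q.1.1) + (p.1.2 + q.1.2) =
      ((realPart x : A) + p.1.1 + p.1.2) + ((realPart x' : A) + q.1.1 + q.1.2) by abel]
  have := norm_add_le ((realPart x : A) + p.1.1 + p.1.2) ((realPart x' : A) + q.1.1 + q.1.2)
  nlinarith [norm_nonneg ψ]

theorem jordanGauge_smul_le (ψ : StrongDual ℂ A) {c : ℝ} (hc : 0 < c) (x : A) :
    jordanGauge ψ (c • x) ≤ c * jordanGauge ψ x := by
  have : Nonempty {p : A × A // 0 ≤ p.1 ∧ 0 ≤ p.2} := ⟨⟨0, le_rfl, le_rfl⟩⟩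
  rw [← div_le_iff₀' hc]
  refine le_ciInf fun p => ?_
  rw [div_le_iff₀' hc]
  refine (jordanGauge_le ψ _ (smul_nonneg hc.le p.2.1) (smul_nonneg hc.le p.2.2)).trans_eq ?_
  rw [map_smul, selfAdjoint.val_smul, ← smul_add, ← smul_add, norm_smul, Real.norm_of_nonneg hc.le,
    ← Complex.coe_smul c p.1.2, map_smul, smul_eq_mul, Complex.re_ofReal_mul]
  ring

theorem jordanGauge_smul (ψ : StrongDual ℂ A) {c : ℝ} (hc : 0 < c) (x : A) :
    jordanGauge ψ (c • x) = c * jordanGauge ψ x := by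
  refine le_antisymm (jordanGauge_smul_le ψ hc x) ?_
  have := jordanGauge_smul_le ψ (inv_pos.mpr hc) (c • x)
  rw [inv_smul_smul₀ hc.ne'] at this
  calc _ ≤ c * (c⁻¹ * jordanGauge ψ (c • x)) := by gcongr
    _ = _ := by field_simp

/-- Jordan decomposition: a functional that is real on positive elements is a difference of
positive functionals. -/
theorem exists_positive_sub (ψ : StrongDual ℂ A) (hψ : ∀ a : A, 0 ≤ a → (ψ a).im = 0) :
    ∃ g h : A →ₚ[ℂ] ℂ, ψ = Bidual.ofPositive g - Bidual.ofPositive h ∧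
      (g 1).re ≤ ‖ψ‖ * ‖(1 : A)‖ ∧ (h 1).re ≤ 2 * ‖ψ‖ * ‖(1 : A)‖ := by
  -- Hahn–Banach from the zero subspace gives a real functional below the gauge. The choice y = w =
  -- 0 makes it vanish on skew-adjoint elements; at −a with a ≥ 0, the choice y = a gives f(a) ≥ 0
  -- and the choice w = a gives f(a) ≥ Re ψ(a).
  obtain ⟨f, -, hf⟩ := exists_extension_of_le_sublinear (⊥ : A →ₗ.[ℝ] ℝ) (jordanGauge ψ)
    (fun c hc x => jordanGauge_smul ψ hc x) (jordanGauge_add_le ψ) (by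
      rintro ⟨x, hx⟩
      obtain rfl : x = 0 := (Submodule.mem_bot ℝ).mp hx
      have : Nonempty {p : A × A // 0 ≤ p.1 ∧ 0 ≤ p.2} := ⟨⟨0, le_rfl, le_rfl⟩⟩
      have h0 : (⊥ : A →ₗ.[ℝ] ℝ) ⟨0, hx⟩ = 0 := LinearPMap.map_zero _
      rw [h0]
      refine le_ciInf fun p => ?_
      simpa using jordanGauge_bound ψ 0 p.2.1 p.2.2)
  have hre : ∀ a : A, 0 ≤ a → (realPart a : A) = a := fun a ha =>
    (IsSelfAdjoint.of_nonneg ha).coe_realPart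
  have hskew : ∀ a : A, (realPart a : A) = 0 → f a = 0 := by
    intro a ha
    have h1 : ∀ b : A, (realPart b : A) = 0 → f b ≤ 0 := fun b hb =>
      (hf b).trans ((jordanGauge_le ψ b le_rfl le_rfl).trans_eq (by simp [hb]))
    refine le_antisymm (h1 a ha) ?_
    have := h1 (-a) (by simp [ha])
    rw [map_neg] at this
    linarith
  have hpos : ∀ a : A, 0 ≤ a → 0 ≤ f a := by
    intro a ha
    have := (hf (-a)).trans (jordanGauge_le ψ (-a) ha le_rfl)
    simp [hre a ha] at this
    exact this
  have hge : ∀ a : A, 0 ≤ a → (ψ a).re ≤ f a := by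
    intro a ha
    have := (hf (-a)).trans (jordanGauge_le ψ (-a) le_rfl ha)
    simp [hre a ha] at this
    exact this
  -- The complexification f(a) − i f(ia); for positive a the second term vanishes, since ia is
  -- skew-adjoint.
  let G : A →ₗ[ℂ] ℂ := Module.Dual.extendRCLike f
  have hG : ∀ a : A, 0 ≤ a → G a = (f a : ℂ) := by
    intro a ha
    change (f a : ℂ) - Complex.I * (f (Complex.I • a) : ℂ) = _
    rw [hskew (Complex.I • a)]
    · simp
    · rw [realPart_I_smul]
      simp [(IsSelfAdjoint.of_nonneg ha).imaginaryPart]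
  let g : A →ₚ[ℂ] ℂ := PositiveLinearMap.mk₀ G fun a ha => by
    rw [hG a ha]; exact_mod_cast hpos a ha
  let h : A →ₚ[ℂ] ℂ := PositiveLinearMap.mk₀ (G - ψ.toLinearMap) fun a ha => by
    have : ψ a = ((ψ a).re : ℂ) := Complex.ext rfl (hψ a ha)
    change 0 ≤ G a - ψ a
    rw [hG a ha, this, ← Complex.ofReal_sub]
    exact_mod_cast sub_nonneg.mpr (hge a ha)
  have hg1 : (g 1).re ≤ ‖ψ‖ * ‖(1 : A)‖ := by
    change (G 1).re ≤ _
    rw [hG 1 zero_le_one, Complex.ofReal_re]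
    refine (hf 1).trans ((jordanGauge_le ψ 1 le_rfl le_rfl).trans_eq ?_)
    simp [mul_comm]
  refine ⟨g, h, ?_, hg1, ?_⟩
  · ext a
    change ψ a = G a - (G a - ψ a)
    ring
  · have : (h 1).re = (g 1).re - (ψ 1).re := rfl
    have h2 := (Complex.abs_re_le_norm (ψ 1)).trans (ψ.le_opNorm 1)
    have := (abs_le.mp h2).1
    linarith

/-- Every functional is a combination of four positive functionals. -/
theorem exists_positive_decomposition (ψ : StrongDual ℂ A) :
    ∃ g₁ g₂ g₃ g₄ : A →ₚ[ℂ] ℂ,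
      ψ = Bidual.ofPositive g₁ - Bidual.ofPositive g₂ +
        Complex.I • (Bidual.ofPositive g₃ - Bidual.ofPositive g₄) ∧
      (g₁ 1).re + (g₂ 1).re + (g₃ 1).re + (g₄ 1).re ≤ 6 * ‖(1 : A)‖ * ‖ψ‖ := by
  have hreal : ∀ φ : StrongDual ℂ A, dualStar φ = φ → ∀ a : A, 0 ≤ a → (φ a).im = 0 := by
    intro φ hφ a ha
    have := DFunLike.congr_fun hφ a
    rw [dualStar_apply, (IsSelfAdjoint.of_nonneg ha).star_eq] at this
    exact Complex.conj_eq_iff_im.mp this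
  -- Real and imaginary parts of ψ; hermitian functionals are real on positive elements.
  let φ₁ : StrongDual ℂ A := (2⁻¹ : ℂ) • (ψ + dualStar ψ)
  let φ₂ : StrongDual ℂ A := (-Complex.I * 2⁻¹ : ℂ) • (ψ - dualStar ψ)
  have h₁ : dualStar φ₁ = φ₁ := by
    ext a; simp [φ₁, add_comm]
  have h₂ : dualStar φ₂ = φ₂ := by
    ext a; simp [φ₂]; ring
  have n₁ : ‖φ₁‖ ≤ ‖ψ‖ := by
    have := norm_add_le ψ (dualStar ψ)
    have := norm_dualStar_le ψ
    simp only [φ₁, norm_smul, norm_inv, Complex.norm_ofNat]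
    linarith
  have n₂ : ‖φ₂‖ ≤ ‖ψ‖ := by
    have := norm_sub_le ψ (dualStar ψ)
    have := norm_dualStar_le ψ
    simp only [φ₂, norm_smul, norm_mul, norm_neg, Complex.norm_I, norm_inv, Complex.norm_ofNat]
    linarith
  obtain ⟨g₁, g₂, hg, b₁, b₂⟩ := exists_positive_sub φ₁ (hreal _ h₁)
  obtain ⟨g₃, g₄, hg', b₃, b₄⟩ := exists_positive_sub φ₂ (hreal _ h₂)
  refine ⟨g₁, g₂, g₃, g₄, ?_, ?_⟩
  · rw [← hg, ← hg']
    ext a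
    simp only [φ₁, φ₂, add_apply, smul_apply, sub_apply, smul_eq_mul]
    linear_combination ((ψ a - dualStar ψ a) / 2) * Complex.I_mul_I
  -- Each of the two hermitian parts costs 1 + 2 in `exists_positive_sub`, whence the constant 6.
  · nlinarith [norm_nonneg (1 : A)]

end Jordan

/-! ### The central projection attached to a positive functional -/

section CentralProjection

variable {A : Type*} [CStarAlgebra A] [PartialOrder A] [StarOrderedRing A] (ω : A →ₚ[ℂ] ℂ)
  {H K : Type*} [NormedAddCommGroup H] [InnerProductSpace ℂ H] [CompleteSpace H]
  [NormedAddCommGroup K] [InnerProductSpace ℂ K] [CompleteSpace K]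

/-- The closed span of the ranges of the intertwiners from the GNS representation of `ω`. -/
def intertwinedPart (π : A →⋆ₐ[ℂ] (H →L[ℂ] H)) : Submodule ℂ H :=
  (Submodule.span ℂ {x | ∃ B : ω.GNS →L[ℂ] H, IsIntertwiner ω.gnsStarAlgHom π B ∧
    ∃ y, B y = x}).topologicalClosure

instance (π : A →⋆ₐ[ℂ] (H →L[ℂ] H)) : CompleteSpace (intertwinedPart ω π) :=
  (Submodule.isClosed_topologicalClosure _).completeSpace_coe

/-- The orthogonal projection onto `intertwinedPart ω π`. -/
def intertwinedProj (π : A →⋆ₐ[ℂ] (H →L[ℂ] H)) : H →L[ℂ] H :=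
  (intertwinedPart ω π).starProjection

variable {ω}

theorem IsIntertwiner.apply_mem_intertwinedPart {π : A →⋆ₐ[ℂ] (H →L[ℂ] H)}
    {B : ω.GNS →L[ℂ] H} (hB : IsIntertwiner ω.gnsStarAlgHom π B) (y : ω.GNS) :
    B y ∈ intertwinedPart ω π :=
  Submodule.le_topologicalClosure _ (Submodule.subset_span ⟨B, hB, y, rfl⟩)

theorem IsIntertwiner.map_intertwinedPart {π : A →⋆ₐ[ℂ] (H →L[ℂ] H)}
    {ρ : A →⋆ₐ[ℂ] (K →L[ℂ] K)} {C : H →L[ℂ] K} (hC : IsIntertwiner π ρ C) {x : H}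
    (hx : x ∈ intertwinedPart ω π) : C x ∈ intertwinedPart ω ρ := by
  have hle : intertwinedPart ω π ≤ (intertwinedPart ω ρ).comap (C : H →ₗ[ℂ] K) := by
    refine Submodule.topologicalClosure_minimal _ (Submodule.span_le.mpr ?_)
      ((Submodule.isClosed_topologicalClosure _).preimage C.continuous)
    rintro _ ⟨B, hB, y, rfl⟩
    exact IsIntertwiner.apply_mem_intertwinedPart (B := C ∘L B)
      (fun a z => by simp only [ContinuousLinearMap.comp_apply]; rw [hB, hC]) y
  exact hle hx

/-- C and its adjoint both preserve the intertwined parts, so C also preserves their orthogonal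
complements. -/
theorem IsIntertwiner.intertwinedProj_apply {π : A →⋆ₐ[ℂ] (H →L[ℂ] H)}
    {ρ : A →⋆ₐ[ℂ] (K →L[ℂ] K)} {C : H →L[ℂ] K} (hC : IsIntertwiner π ρ C) (x : H) :
    C (intertwinedProj ω π x) = intertwinedProj ω ρ (C x) := by
  refine (Submodule.eq_starProjection_of_mem_orthogonal
    (hC.map_intertwinedPart (Submodule.starProjection_apply_mem _ _)) ?_).symm
  rw [← map_sub, Submodule.mem_orthogonal]
  intro y hy
  rw [← ContinuousLinearMap.adjoint_inner_left]
  exact Submodule.sub_starProjection_mem_orthogonal x _ (hC.adjoint.map_intertwinedPart hy)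

theorem intertwinedProj_apply_self {π : A →⋆ₐ[ℂ] (H →L[ℂ] H)} {x : H}
    (hx : x ∈ intertwinedPart ω π) : intertwinedProj ω π x = x :=
  Submodule.starProjection_eq_self_iff.mpr hx

theorem map_mem_intertwinedPart (π : A →⋆ₐ[ℂ] (H →L[ℂ] H)) (a : A) {x : H}
    (hx : x ∈ intertwinedPart ω π) : π a x ∈ intertwinedPart ω π := by
  have hle : intertwinedPart ω π ≤ (intertwinedPart ω π).comap (π a : H →ₗ[ℂ] H) := by
    refine Submodule.topologicalClosure_minimal _ (Submodule.span_le.mpr ?_)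
      ((Submodule.isClosed_topologicalClosure _).preimage (π a).continuous)
    rintro _ ⟨B, hB, y, rfl⟩
    change π a (B y) ∈ intertwinedPart ω π
    rw [← hB]
    exact hB.apply_mem_intertwinedPart _
  exact hle hx

theorem isIntertwiner_intertwinedProj (π : A →⋆ₐ[ℂ] (H →L[ℂ] H)) :
    IsIntertwiner π π (intertwinedProj ω π) := by
  intro a y
  refine Submodule.eq_starProjection_of_mem_orthogonal
    (map_mem_intertwinedPart π a (Submodule.starProjection_apply_mem _ _)) ?_
  rw [← map_sub, Submodule.mem_orthogonal]
  intro z hz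
  rw [← inner_map_star_left]
  exact Submodule.sub_starProjection_mem_orthogonal y _ (map_mem_intertwinedPart π _ hz)

/-! ### The central projection as a bounded functional on the dual. -/

variable (ω)

/-- The pairs `(⟨ζ, π_g(·) ξ_g⟩, ⟨ζ, e_g ξ_g⟩)`, for positive functionals `g`, where `e_g` is the
projection onto the part of the GNS space of `g` that is intertwined with that of `ω`. -/
def supportGraph : Submodule ℂ (StrongDual ℂ A × ℂ) where
  carrier := {p | ∃ (g : A →ₚ[ℂ] ℂ) (ζ : g.GNS),
    p.1 = matrixCoeff g.gnsStarAlgHom ζ (gnsVector g) ∧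
      p.2 = ⟪ζ, intertwinedProj ω g.gnsStarAlgHom (gnsVector g)⟫_ℂ}
  zero_mem' := ⟨0, 0, by ext a; simp, by simp⟩
  add_mem' := by
    rintro ⟨_, _⟩ ⟨_, _⟩ ⟨g, ζ, rfl, rfl⟩ ⟨g', ζ', rfl, rfl⟩
    have hle : ∀ k : A →ₚ[ℂ] ℂ, ∀ a, 0 ≤ (k (star a * a)).re := fun k a =>
      (Complex.le_def.mp (k.map_nonneg (star_mul_self_nonneg a))).1
    -- Both g and g' are dominated by g + g', so their cyclic vectors are images of that of the sum;
    -- the adjoints bring ζ and ζ' into one GNS space.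
    obtain ⟨C, hC, hCξ⟩ := exists_intertwiner (ω := g + g') g.gnsStarAlgHom (gnsVector g)
      fun a => by
        rw [norm_gns_apply_sq]
        simpa using hle g' a
    obtain ⟨D, hD, hDξ⟩ := exists_intertwiner (ω := g + g') g'.gnsStarAlgHom (gnsVector g')
      fun a => by
        rw [norm_gns_apply_sq]
        simpa using hle g a
    refine ⟨g + g', ContinuousLinearMap.adjoint C ζ + ContinuousLinearMap.adjoint D ζ', ?_, ?_⟩
    · ext a
      have h1 := DFunLike.congr_fun (hC.matrixCoeff_adjoint ζ (gnsVector (g + g'))) a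
      have h2 := DFunLike.congr_fun (hD.matrixCoeff_adjoint ζ' (gnsVector (g + g'))) a
      rw [hCξ] at h1
      rw [hDξ] at h2
      rw [matrixCoeff_apply, inner_add_left]
      exact (congrArg₂ (· + ·) h1 h2).symm
    · change _ + _ = _
      rw [inner_add_left, ContinuousLinearMap.adjoint_inner_left,
        ContinuousLinearMap.adjoint_inner_left, hC.intertwinedProj_apply,
        hD.intertwinedProj_apply, hCξ, hDξ]
  smul_mem' := by
    rintro r ⟨_, _⟩ ⟨g, ζ, rfl, rfl⟩
    refine ⟨g, star r • ζ, ?_, ?_⟩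
    · ext a
      simp [mul_comm]
    · simp

/-- The cyclic subrepresentation generated by y is the GNS representation of its vector functional,
so arbitrary representations reduce to the cyclic ones of the graph. -/
theorem mem_supportGraph_of_rep (π : A →⋆ₐ[ℂ] (H →L[ℂ] H)) (x y : H) :
    (matrixCoeff π x y, ⟪x, intertwinedProj ω π y⟫_ℂ) ∈ supportGraph ω := by
  obtain ⟨C, hC, hCy⟩ := exists_intertwiner (ω := vectorFunctional π y) π y fun a => by
    rw [re_vectorFunctional_star_mul]
  refine ⟨vectorFunctional π y, ContinuousLinearMap.adjoint C x, ?_, ?_⟩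
  · rw [hC.matrixCoeff_adjoint, hCy]
  · rw [ContinuousLinearMap.adjoint_inner_left, hC.intertwinedProj_apply, hCy]

variable {ω}

/-- If the coefficient vanishes, ζ is orthogonal to the dense set of vectors π_g(a)ξ_g. By linearity
the graph is single valued. -/
theorem eq_zero_of_zero_mem_supportGraph {c : ℂ} (h : ((0 : StrongDual ℂ A), c) ∈ supportGraph ω) :
    c = 0 := by
  obtain ⟨g, ζ, h0, rfl⟩ := h
  have : ζ = 0 := (denseRange_gns g).eq_zero_of_inner_left ℂ fun a =>
    (DFunLike.congr_fun h0 a).symm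
  rw [this]
  exact inner_zero_left _

theorem supportGraph_unique {ψ : StrongDual ℂ A} {c d : ℂ} (hc : (ψ, c) ∈ supportGraph ω)
    (hd : (ψ, d) ∈ supportGraph ω) : c = d := by
  have h := (supportGraph ω).sub_mem hc hd
  rw [Prod.mk_sub_mk, sub_self] at h
  exact sub_eq_zero.mp (eq_zero_of_zero_mem_supportGraph h)

variable (ω)

/-- The graph is everywhere defined and bounded: a positive g contributes at most ‖ξ_g‖² = g(1), and
four such functionals suffice. -/
theorem exists_mem_supportGraph (ψ : StrongDual ℂ A) :
    ∃ c, (ψ, c) ∈ supportGraph ω ∧ ‖c‖ ≤ 6 * ‖(1 : A)‖ * ‖ψ‖ := by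
  have hpos : ∀ g : A →ₚ[ℂ] ℂ, ∃ c, (Bidual.ofPositive g, c) ∈ supportGraph ω ∧
      ‖c‖ ≤ (g 1).re := by
    intro g
    refine ⟨_, ⟨g, gnsVector g, (matrixCoeff_gnsVector g).symm, rfl⟩, ?_⟩
    refine (norm_inner_le_norm _ _).trans ?_
    rw [← norm_gnsVector_sq, sq]
    gcongr
    exact Submodule.norm_starProjection_apply_le _ _
  obtain ⟨g₁, g₂, g₃, g₄, hψ, hb⟩ := exists_positive_decomposition ψ
  obtain ⟨c₁, h₁, b₁⟩ := hpos g₁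
  obtain ⟨c₂, h₂, b₂⟩ := hpos g₂
  obtain ⟨c₃, h₃, b₃⟩ := hpos g₃
  obtain ⟨c₄, h₄, b₄⟩ := hpos g₄
  refine ⟨c₁ - c₂ + Complex.I • (c₃ - c₄), ?_, ?_⟩
  · rw [hψ]
    exact (supportGraph ω).add_mem ((supportGraph ω).sub_mem h₁ h₂)
      ((supportGraph ω).smul_mem _ ((supportGraph ω).sub_mem h₃ h₄))
  · have e₁ := norm_add_le (c₁ - c₂) (Complex.I • (c₃ - c₄))
    have e₂ := norm_sub_le c₁ c₂
    have e₃ := norm_sub_le c₃ c₄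
    rw [norm_smul, Complex.norm_I, one_mul] at e₁
    linarith

/-- The central projection of the bidual which acts in every representation as the projection onto
the part intertwined with the GNS representation of `ω`. -/
def centralProj : Bidual A :=
  LinearMap.mkContinuous
    { toFun := fun ψ => (exists_mem_supportGraph ω ψ).choose
      map_add' := fun ψ φ => supportGraph_unique (exists_mem_supportGraph ω _).choose_spec.1
        ((supportGraph ω).add_mem (exists_mem_supportGraph ω ψ).choose_spec.1
          (exists_mem_supportGraph ω φ).choose_spec.1)
      map_smul' := fun r ψ => supportGraph_unique (exists_mem_supportGraph ω _).choose_spec.1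
        ((supportGraph ω).smul_mem r (exists_mem_supportGraph ω ψ).choose_spec.1) }
    (6 * ‖(1 : A)‖) fun ψ => (exists_mem_supportGraph ω ψ).choose_spec.2

theorem bidualRep_centralProj (π : A →⋆ₐ[ℂ] (H →L[ℂ] H)) :
    bidualRep π (centralProj ω) = intertwinedProj ω π := by
  ext y
  refine ext_inner_left ℂ fun x => ?_
  rw [inner_bidualRep]
  exact supportGraph_unique (exists_mem_supportGraph ω _).choose_spec.1
    (mem_supportGraph_of_rep ω π x y)

/-! ### Centrality and minimality of the projection. -/

theorem Bidual.apply_ofPositive (F : Bidual A) (g : A →ₚ[ℂ] ℂ) :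
    F (Bidual.ofPositive g) = ⟪gnsVector g, bidualRep g.gnsStarAlgHom F (gnsVector g)⟫_ℂ := by
  rw [inner_bidualRep, matrixCoeff_gnsVector]

/-- The GNS representations separate the points of the bidual. -/
theorem Bidual.ext_gns {F G : Bidual A}
    (h : ∀ g : A →ₚ[ℂ] ℂ, bidualRep g.gnsStarAlgHom F = bidualRep g.gnsStarAlgHom G) : F = G := by
  have hpos : ∀ g : A →ₚ[ℂ] ℂ, F (Bidual.ofPositive g) = G (Bidual.ofPositive g) := fun g => by
    rw [Bidual.apply_ofPositive, Bidual.apply_ofPositive, h]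
  ext ψ
  obtain ⟨g₁, g₂, g₃, g₄, hψ, -⟩ := exists_positive_decomposition ψ
  rw [hψ]
  simp only [map_add, map_sub, map_smul, hpos]

theorem isStarProjection_centralProj : IsStarProjection (centralProj ω) := by
  constructor
  · refine Bidual.ext_gns fun g => ?_
    rw [bidualRep_mul, bidualRep_centralProj]
    exact (Submodule.isIdempotentElem_starProjection _)
  · refine Bidual.ext_gns fun g => ?_
    rw [bidualRep_star, bidualRep_centralProj]
    exact (isSelfAdjoint_starProjection _)

/-- In each GNS representation the projection is a self-intertwiner, hence commutes with the action
of the whole bidual. -/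
theorem centralProj_mul_comm (F : Bidual A) : centralProj ω * F = F * centralProj ω := by
  refine Bidual.ext_gns fun g => ?_
  rw [bidualRep_mul, bidualRep_mul, bidualRep_centralProj]
  ext x
  exact ((isIntertwiner_intertwinedProj g.gnsStarAlgHom).bidualRep_apply F x)

/-- If the cyclic vector is separating, then the support is a central projection. -/
theorem isSupport_centralProj
    (hsep : ∀ T ∈ gnsBicommutant ω, T (gnsVector ω) = 0 → T = 0) :
    Bidual.IsSupport ω (centralProj ω) := by
  have hξ : gnsVector ω ∈ intertwinedPart ω ω.gnsStarAlgHom :=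
    IsIntertwiner.apply_mem_intertwinedPart (B := ContinuousLinearMap.id ℂ ω.GNS)
      (fun _ _ => rfl) _
  have hω : ⟪gnsVector ω, gnsVector ω⟫_ℂ = ω 1 := by
    simpa using inner_gnsVector ω 1 1
  refine ⟨isStarProjection_centralProj ω, ?_, fun q hq hq1 => ?_⟩
  · rw [Bidual.apply_ofPositive, bidualRep_centralProj, intertwinedProj_apply_self hξ, hω]
  set Q := bidualRep ω.gnsStarAlgHom q with hQ
  have hQQ : Q * Q = Q := by rw [hQ, ← bidualRep_mul, hq.isIdempotentElem.eq]
  have hQs : ContinuousLinearMap.adjoint Q = Q := by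
    rw [hQ, ← bidualRep_star, hq.isSelfAdjoint.star_eq]
  -- For a projection Q, ⟨ξ, Qξ⟩ = ⟨ξ, ξ⟩ forces ‖Qξ − ξ‖² = 0.
  have hQξ : Q (gnsVector ω) = gnsVector ω := by
    rw [Bidual.apply_ofPositive, ← hω, ← hQ] at hq1
    rw [← sub_eq_zero, ← inner_self_eq_zero (𝕜 := ℂ), inner_sub_sub_self,
      ← ContinuousLinearMap.adjoint_inner_right, hQs]
    change ⟪_, (Q * Q) _⟫_ℂ - _ - _ + _ = _
    rw [hQQ, ← ContinuousLinearMap.adjoint_inner_right, hQs, hq1]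
    ring
  -- Separation enters here: Q − 1 is in the bicommutant and kills ξ.
  have hQ1 : Q = 1 := by
    have hmem := bidualRep_mem_bicommutant ω.gnsStarAlgHom q
    refine sub_eq_zero.mp (hsep _ ?_ (by simp [hQξ]))
    intro C hC
    rw [mul_sub, sub_mul, mul_one, one_mul, hmem C hC]
  -- Acting as 1 on the GNS space of `ω`, q fixes the range of every intertwiner out of it.
  have hle : q * centralProj ω = centralProj ω := by
    refine Bidual.ext_gns fun g => ?_
    rw [bidualRep_mul, bidualRep_centralProj]
    have : intertwinedPart ω g.gnsStarAlgHom ≤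
        LinearMap.eqLocus (bidualRep g.gnsStarAlgHom q : g.GNS →ₗ[ℂ] g.GNS) LinearMap.id := by
      refine Submodule.topologicalClosure_minimal _ (Submodule.span_le.mpr ?_)
        (isClosed_eq (bidualRep g.gnsStarAlgHom q).continuous continuous_id)
      rintro _ ⟨B, hB, y, rfl⟩
      change bidualRep g.gnsStarAlgHom q (B y) = B y
      rw [← hB.bidualRep_apply, ← hQ, hQ1]
      rfl
    ext x
    exact this (Submodule.starProjection_apply_mem _ x)
  exact ⟨(centralProj_mul_comm ω q).trans hle, hle⟩

end CentralProjection

/-! ### Trigonometric polynomials -/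

/-- The character `z ↦ z ^ m` of the circle. -/
def circleMonomial (m : ℤ) : C(Circle, ℂ) where
  toFun z := (z : ℂ) ^ m
  continuous_toFun := by
    have h : Continuous fun z : Circle => ((z ^ m : Circle) : ℂ) :=
      (continuous_induced_dom : Continuous fun z : Circle => (z : ℂ)).comp (continuous_zpow m)
    simpa only [Circle.coe_zpow] using h

/-- The trigonometric polynomial with given coefficients. -/
def trigPoly : (ℤ →₀ ℂ) →ₗ[ℂ] C(Circle, ℂ) := Finsupp.linearCombination ℂ circleMonomial

theorem circleMonomial_mul (m n : ℤ) :
    circleMonomial m * circleMonomial n = circleMonomial (m + n) := by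
  ext z
  exact (zpow_add₀ (Circle.coe_ne_zero z) m n).symm

theorem star_circleMonomial (m : ℤ) : star (circleMonomial m) = circleMonomial (-m) := by
  ext z
  change (starRingEnd ℂ) ((z : ℂ) ^ m) = (z : ℂ) ^ (-m)
  rw [map_zpow₀, ← Circle.coe_inv_eq_conj, Circle.coe_inv, inv_zpow, zpow_neg]

/-- The star subalgebra of trigonometric polynomials. -/
def trigSubalgebra : StarSubalgebra ℂ C(Circle, ℂ) where
  carrier := Submodule.span ℂ (Set.range circleMonomial)
  mul_mem' {f g} hf hg := by
    induction hf, hg using Submodule.span_induction₂ with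
    | mem_mem x y hx hy =>
      obtain ⟨m, rfl⟩ := hx
      obtain ⟨n, rfl⟩ := hy
      rw [circleMonomial_mul]
      exact Submodule.subset_span ⟨_, rfl⟩
    | zero_left => simp
    | zero_right => simp
    | add_left x y z _ _ _ h1 h2 => rw [add_mul]; exact add_mem h1 h2
    | add_right x y z _ _ _ h1 h2 => rw [mul_add]; exact add_mem h1 h2
    | smul_left r x y _ _ h => rw [smul_mul_assoc]; exact Submodule.smul_mem _ _ h
    | smul_right r x y _ _ h => rw [mul_smul_comm]; exact Submodule.smul_mem _ _ h
  add_mem' := add_mem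
  algebraMap_mem' r := by
    rw [Algebra.algebraMap_eq_smul_one]
    refine Submodule.smul_mem _ _ (Submodule.subset_span ⟨0, ?_⟩)
    ext z
    exact zpow_zero _
  star_mem' {f} hf := by
    change star f ∈ Submodule.span ℂ (Set.range circleMonomial)
    induction hf using Submodule.span_induction with
    | mem x hx =>
      obtain ⟨m, rfl⟩ := hx
      rw [star_circleMonomial]
      exact Submodule.subset_span ⟨_, rfl⟩
    | zero => simp
    | add x y _ _ h1 h2 => rw [star_add]; exact add_mem h1 h2
    | smul r x _ h => rw [star_smul]; exact Submodule.smul_mem _ _ h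

/-- Stone–Weierstrass: the character z already separates points. -/
theorem denseRange_trigPoly : DenseRange trigPoly := by
  have h : trigSubalgebra.topologicalClosure = ⊤ := by
    apply ContinuousMap.starSubalgebra_topologicalClosure_eq_top_of_separatesPoints
    intro x y hxy
    refine ⟨_, ⟨circleMonomial 1, Submodule.subset_span ⟨1, rfl⟩, rfl⟩, ?_⟩
    simpa [circleMonomial] using Circle.coe_inj.not.mpr hxy
  intro f
  have hf : f ∈ trigSubalgebra.topologicalClosure := by rw [h]; trivial
  refine closure_mono ?_ hf
  intro g hg
  exact Finsupp.mem_span_range_iff_exists_finsupp.mp hg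

/-- Trigonometric polynomials are dense in `L²` of a finite measure. -/
theorem denseRange_toLp_trigPoly (μ : MeasureTheory.Measure Circle)
    [MeasureTheory.IsFiniteMeasure μ] :
    DenseRange fun c => ContinuousMap.toLp (E := ℂ) 2 μ ℂ (trigPoly c) :=
  (ContinuousMap.toLp_denseRange ℂ μ ℂ (by simp)).comp denseRange_trigPoly
    (ContinuousMap.toLp 2 μ ℂ).continuous

/-- `u ↦ ∫ ‖u‖² G` is continuous on `L²` for a bounded `G`. -/
theorem continuous_integral_normSq_mul {X : Type*} [MeasurableSpace X] [TopologicalSpace X]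
    [BorelSpace X] [CompactSpace X] (μ : MeasureTheory.Measure X)
    [MeasureTheory.IsFiniteMeasure μ] (G : C(X, ℂ)) :
    Continuous fun u : MeasureTheory.Lp ℂ 2 μ => ∫ z, (‖u z‖ ^ 2 : ℝ) * G z ∂μ := by
  have hG : MeasureTheory.MemLp G ⊤ μ :=
    MeasureTheory.memLp_top_of_bound G.continuous.aestronglyMeasurable ‖G‖
      (Filter.Eventually.of_forall G.norm_coe_le_norm)
  -- Multiplication by G is bounded on L², so the integral is the continuous quadratic form ⟨u, Bu⟩.
  let B : MeasureTheory.Lp ℂ 2 μ →L[ℂ] MeasureTheory.Lp ℂ 2 μ :=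
    (ContinuousLinearMap.mul ℂ ℂ).holderL μ ⊤ 2 2 hG.toLp
  have hB : ∀ u : MeasureTheory.Lp ℂ 2 μ, ⟪u, B u⟫_ℂ = ∫ z, (‖u z‖ ^ 2 : ℝ) * G z ∂μ := by
    intro u
    rw [MeasureTheory.L2.inner_def]
    refine MeasureTheory.integral_congr_ae ?_
    filter_upwards [(ContinuousLinearMap.mul ℂ ℂ).coeFn_holder hG.toLp u (r := 2), hG.coeFn_toLp]
      with z h1 h2
    have h1' : B u z = G z * u z := by
      rw [← h2]; exact h1
    rw [h1', RCLike.inner_apply, mul_assoc, RCLike.mul_conj, mul_comm]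
    norm_cast
  simp only [← hB]
  exact continuous_id.inner B.continuous

/-! ### The fibre representations -/

namespace NCTorus

variable (α : ℝ)

theorem ext_weyl {E : Type*} [NormedAddCommGroup E] [NormedSpace ℂ E]
    {f g : NCTorus α →L[ℂ] E} (h : ∀ a, f (weyl α a) = g (weyl α a)) : f = g := by
  ext a
  have ha : a ∈ closure (Submodule.span ℂ (Set.range (weyl α)) : Set (NCTorus α)) := by
    rw [closure_span_weyl]; trivial
  refine closure_minimal (t := {a | f a = g a}) ?_ (isClosed_eq f.continuous g.continuous) ha
  have : Submodule.span ℂ (Set.range (weyl α)) ≤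
      LinearMap.eqLocus (f : NCTorus α →ₗ[ℂ] E) (g : NCTorus α →ₗ[ℂ] E) := by
    rw [Submodule.span_le]
    rintro _ ⟨a, rfl⟩
    exact h a
  exact this

/-- The representation on `ℓ²(ℤ)` attached to a point of the circle. -/
def fiberRep (z : Circle) : NCTorus α →⋆ₐ[ℂ] (Ell2 →L[ℂ] Ell2) := eval α (fiberPair α z)

/-- The basis vectors of `ℓ²(ℤ)`. -/
def basisVec (n : ℤ) : Ell2 := lp.single 2 n 1

theorem fiberState_eq_matrixCoeff (z : Circle) (a : NCTorus α) :
    fiberState α z a = matrixCoeff (fiberRep α z) (basisVec 0) (basisVec 0) a := rfl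

theorem fiberRep_weyl_apply (z : Circle) (m n : ℤ) (g : Ell2) (j : ℤ) :
    fiberRep α z (weyl α (m, n)) g j = Complex.exp (-(2 * Real.pi * Complex.I * α * m * n)) *
      (((Circle.exp (4 * Real.pi * α * j) * z : Circle) : ℂ) ^ m * g (j - n)) := by
  have hU : Unitary.map (evalMon α (fiberPair α z)) (U α) = (fiberPair α z).u := rfl
  have hV : Unitary.map (evalMon α (fiberPair α z)) (V α) = (fiberPair α z).v := rfl
  have h : fiberRep α z ((U α ^ m * V α ^ n : unitary (NCTorus α)) : NCTorus α) =
      ((diagHom (fun n => Circle.exp (4 * Real.pi * α * n) * z) ^ m *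
        shiftHom (Multiplicative.ofAdd 1) ^ n : unitary (Ell2 →L[ℂ] Ell2)) :
          Ell2 →L[ℂ] Ell2) := by
    change ((Unitary.map (evalMon α (fiberPair α z))
      (U α ^ m * V α ^ n) : unitary (fiberPair α z).carrier) : (fiberPair α z).carrier) = _
    rw [map_mul, map_zpow, map_zpow, hU, hV]
    rfl
  rw [weyl, map_smul, h, ← map_zpow, ← map_zpow, ← ofAdd_zsmul]
  change Complex.exp _ * ((_ : Ell2 →L[ℂ] Ell2) _ : Ell2) j = _
  rw [Submonoid.coe_mul, mul_apply_eq_comp]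
  simp only [diagHom, shiftHom, MonoidHom.coe_mk, OneHom.coe_mk, twist_apply]
  simp

theorem fiberRep_weyl_basisVec (z : Circle) (m n : ℤ) :
    ∃ c : ℂ, ‖c‖ = 1 ∧ fiberRep α z (weyl α (m, n)) (basisVec 0) = c • basisVec n := by
  refine ⟨Complex.exp (-(2 * Real.pi * Complex.I * α * m * n)) *
      ((Circle.exp (4 * Real.pi * α * n) * z : Circle) : ℂ) ^ m, ?_, ?_⟩
  · rw [norm_mul, norm_zpow, Circle.norm_coe, one_zpow, mul_one,
      show -(2 * Real.pi * Complex.I * α * m * n) =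
        ((-(2 * Real.pi * α * m * n) : ℝ) : ℂ) * Complex.I by push_cast; ring,
      Complex.norm_exp_ofReal_mul_I]
  · apply lp.ext
    funext j
    rw [fiberRep_weyl_apply, lp.coeFn_smul, Pi.smul_apply, smul_eq_mul, mul_assoc]
    by_cases hj : j = n
    · subst hj; simp [basisVec]
    · have : j - n ≠ 0 := sub_ne_zero.mpr hj
      simp [basisVec, hj, this]

/-- The n-th diagonal entry of U is e^{4πiαn}z, so passing from δ₀ to δₙ rotates z by R^{2n}; on
W(m,k) with k ≠ 0 both sides vanish. -/
theorem matrixCoeff_basisVec (z : Circle) (n : ℤ) :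
    matrixCoeff (fiberRep α z) (basisVec n) (basisVec n) =
      matrixCoeff (fiberRep α (Circle.exp (4 * Real.pi * α * n) * z))
        (basisVec 0) (basisVec 0) := by
  apply ext_weyl
  rintro ⟨m, k⟩
  rw [matrixCoeff_apply, matrixCoeff_apply, basisVec, basisVec, lp.inner_single_left,
    lp.inner_single_left, fiberRep_weyl_apply, fiberRep_weyl_apply]
  by_cases hk : k = 0
  · subst hk; simp
  · have : n - k ≠ n := by omega
    simp [hk, this]

/-- W(m,n) sends δ₀ to a unimodular multiple of δₙ, and the phase cancels in the coefficient. -/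
theorem fiberState_weyl_conj (z : Circle) (m n : ℤ) (a : NCTorus α) :
    fiberState α z (star (weyl α (m, n)) * a * weyl α (m, n)) =
      fiberState α (Circle.exp (4 * Real.pi * α * n) * z) a := by
  obtain ⟨c, hc, hw⟩ := fiberRep_weyl_basisVec α z m n
  rw [fiberState_eq_matrixCoeff, fiberState_eq_matrixCoeff, ← matrixCoeff_basisVec,
    matrixCoeff_apply, matrixCoeff_apply, mul_assoc, ← inner_map_map, hw, map_mul]
  change ⟪_, fiberRep α z a (fiberRep α z (weyl α (m, n)) _)⟫_ℂ = _
  rw [hw, map_smul, inner_smul_left, inner_smul_right, ← mul_assoc, RCLike.conj_mul, hc]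
  simp

/-- The trigonometric polynomials in the generator `U`. -/
def trigElem : (ℤ →₀ ℂ) →ₗ[ℂ] NCTorus α :=
  Finsupp.linearCombination ℂ fun m => weyl α (m, 0)

/-- δ₀ is an eigenvector of U with eigenvalue z. -/
theorem fiberRep_trigElem (z : Circle) (c : ℤ →₀ ℂ) :
    fiberRep α z (trigElem α c) (basisVec 0) = trigPoly c z • basisVec 0 := by
  induction c using Finsupp.induction_linear with
  | zero => simp
  | add f g hf hg =>
    simp only [map_add, add_apply, ContinuousMap.add_apply, add_smul, hf, hg]
  | single m r =>
    have h : fiberRep α z (weyl α (m, 0)) (basisVec 0) = (z : ℂ) ^ m • basisVec 0 := by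
      apply lp.ext
      funext j
      rw [fiberRep_weyl_apply, lp.coeFn_smul, Pi.smul_apply, smul_eq_mul]
      by_cases hj : j = 0
      · subst hj; simp
      · simp [basisVec, hj]
    rw [trigElem, trigPoly, Finsupp.linearCombination_single, Finsupp.linearCombination_single,
      map_smul, smul_apply, h, ContinuousMap.smul_apply, smul_assoc]
    rfl

theorem fiberState_trigElem_conj (z : Circle) (c : ℤ →₀ ℂ) (a : NCTorus α) :
    fiberState α z (star (trigElem α c) * a * trigElem α c) =
      (‖trigPoly c z‖ ^ 2 : ℝ) * fiberState α z a := by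
  rw [fiberState_eq_matrixCoeff, fiberState_eq_matrixCoeff,
    matrixCoeff_apply, matrixCoeff_apply, mul_assoc, ← inner_map_map, map_mul]
  change ⟪_, fiberRep α z a (fiberRep α z _ _)⟫_ℂ = _
  rw [fiberRep_trigElem, map_smul, inner_smul_left, inner_smul_right, ← mul_assoc, RCLike.conj_mul]
  norm_cast

/-! ### The state as an integral of fibre states -/

variable (μ : MeasureTheory.Measure Circle) [MeasureTheory.IsProbabilityMeasure μ]

theorem integrable_fiberState (a : NCTorus α) :
    MeasureTheory.Integrable (fun z => fiberState α z a) μ :=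
  (continuous_fiberState α a).integrable_of_hasCompactSupport
    (HasCompactSupport.of_compactSpace _)

theorem state_weyl (a : ℤ × ℤ) :
    state α μ (weyl α a) = if a.2 = 0 then fourierAnti μ a.1 else 0 := by
  obtain ⟨m, n⟩ := a
  have h : weylSum α (Finsupp.single (m, n) 1) = weyl α (m, n) := by simp [weylSum]
  rw [← h, state_weylSum, finsum_eq_single _ m]
  · by_cases hn : n = 0
    · subst hn; simp
    · simp [hn]
  · intro k hk
    simp [hk.symm]

theorem state_eq_integral (a : NCTorus α) : state α μ a = ∫ z, fiberState α z a ∂μ := by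
  let I : NCTorus α →L[ℂ] ℂ := LinearMap.mkContinuous
    { toFun := fun a => ∫ z, fiberState α z a ∂μ
      map_add' := fun a b => by
        simp only [fiberState_add]
        exact MeasureTheory.integral_add (integrable_fiberState α μ a) (integrable_fiberState α μ b)
      map_smul' := fun r a => by
        simp only [fiberState_smul]
        exact MeasureTheory.integral_const_mul _ _ } 1 fun a => by
      refine (MeasureTheory.norm_integral_le_of_norm_le_const
        (Filter.Eventually.of_forall fun z => norm_fiberState_le α z a)).trans_eq ?_
      simp
  have h : Bidual.ofPositive (state α μ) = I := by
    apply ext_weyl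
    rintro ⟨m, n⟩
    refine (state_weyl α μ (m, n)).trans ?_
    change _ = ∫ z, fiberState α z (weyl α (m, n)) ∂μ
    simp only [fiberState_weyl]
    split_ifs
    · rfl
    · simp
  exact DFunLike.congr_fun h a

theorem state_weyl_conj (m n : ℤ) (a : NCTorus α) :
    state α μ (star (weyl α (m, n)) * a * weyl α (m, n)) =
      ∫ z, fiberState α (Circle.exp (4 * Real.pi * α * n) * z) a ∂μ := by
  rw [state_eq_integral]
  simp only [fiberState_weyl_conj]

theorem state_trigElem_conj (c : ℤ →₀ ℂ) (a : NCTorus α) :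
    state α μ (star (trigElem α c) * a * trigElem α c) =
      ∫ z, (‖trigPoly c z‖ ^ 2 : ℝ) * fiberState α z a ∂μ := by
  rw [state_eq_integral]
  simp only [fiberState_trigElem_conj]

end NCTorus

theorem circleRotation_zpow_apply (α : ℝ) (k : ℤ) (z : Circle) :
    (circleRotation α ^ k) z = Circle.exp (2 * Real.pi * α * k) * z := by
  have h : ∀ w, circleRotation α w = Circle.exp (2 * Real.pi * α) * w := fun _ => rfl
  induction k generalizing z with
  | zero => simp
  | succ n ih =>
    rw [zpow_add_one]
    change (circleRotation α ^ (n : ℤ)) (circleRotation α z) = _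
    rw [ih, h, ← mul_assoc, ← Circle.exp_add]
    congr 2
    push_cast
    ring
  | pred n ih =>
    rw [zpow_sub_one]
    change (circleRotation α ^ (-n : ℤ)) ((circleRotation α).symm z) = _
    have hs : (circleRotation α).symm z = Circle.exp (-(2 * Real.pi * α)) * z := by
      rw [Homeomorph.symm_apply_eq, h, ← mul_assoc, ← Circle.exp_add]
      simp
    rw [ih, hs, ← mul_assoc, ← Circle.exp_add]
    congr 2
    push_cast
    ring

/-! ### The cyclic vector is separating -/

namespace NCTorus

variable (α : ℝ) (μ : MeasureTheory.Measure Circle) [MeasureTheory.IsProbabilityMeasure μ]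

theorem norm_gns_mul_sq {A : Type*} [CStarAlgebra A] [PartialOrder A] [StarOrderedRing A]
    (ω : A →ₚ[ℂ] ℂ) (a x : A) :
    ‖ω.gnsStarAlgHom a (ω.gnsStarAlgHom x (gnsVector ω))‖ ^ 2 =
      (ω (star x * (star a * a) * x)).re := by
  have h : ω.gnsStarAlgHom a (ω.gnsStarAlgHom x (gnsVector ω)) =
      ω.gnsStarAlgHom (a * x) (gnsVector ω) := by rw [map_mul]; rfl
  rw [h, norm_gns_apply_sq, star_mul]
  simp only [mul_assoc]

/-- The vector `π(trigElem c) ξ`. -/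
def trigVec (c : ℤ →₀ ℂ) : (state α μ).GNS :=
  (state α μ).gnsStarAlgHom (trigElem α c) (gnsVector (state α μ))

theorem norm_gns_trigVec_sq (c : ℤ →₀ ℂ) (a : NCTorus α) :
    ((‖(state α μ).gnsStarAlgHom a (trigVec α μ c)‖ ^ 2 : ℝ)) =
      (∫ z, (‖ContinuousMap.toLp (E := ℂ) 2 μ ℂ (trigPoly c) z‖ ^ 2 : ℝ) *
        fiberState α z (star a * a) ∂μ).re := by
  rw [trigVec, norm_gns_mul_sq, state_trigElem_conj]
  congr 1
  refine MeasureTheory.integral_congr_ae ?_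
  filter_upwards [ContinuousMap.coeFn_toLp (p := 2) μ (𝕜 := ℂ) (trigPoly c)] with z hz
  rw [hz]

/-- The case a = 1 of `norm_gns_trigVec_sq`; it lets p ↦ π(p(U))ξ extend isometrically to L²(μ). -/
theorem norm_trigVec (c : ℤ →₀ ℂ) :
    ‖trigVec α μ c‖ = ‖ContinuousMap.toLp (E := ℂ) 2 μ ℂ (trigPoly c)‖ := by
  refine (sq_eq_sq₀ (norm_nonneg _) (norm_nonneg _)).mp ?_
  have h := norm_gns_trigVec_sq α μ c 1
  rw [map_one] at h
  refine Eq.trans h ?_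
  rw [norm_sq_eq_re_inner (𝕜 := ℂ), MeasureTheory.L2.inner_def]
  change (_ : ℂ).re = (_ : ℂ).re
  congr 1
  refine MeasureTheory.integral_congr_ae (Filter.Eventually.of_forall fun z => ?_)
  have h1 : fiberState α z (star (1 : NCTorus α) * 1) = 1 := by
    rw [fiberState_eq, star_one, one_mul, map_one]
    change (lp.single 2 0 1 : Ell2) 0 = 1
    simp
  beta_reduce
  rw [h1, mul_one, inner_self_eq_norm_sq_to_K]
  norm_cast

/-- Every `L²` function gives a vector in the closed span of the `π(W(m, 0)) ξ`. -/
theorem exists_vector_of_Lp (s : MeasureTheory.Lp ℂ 2 μ) :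
    ∃ η ∈ closure (Set.range (trigVec α μ)), ∀ a : NCTorus α,
      ‖(state α μ).gnsStarAlgHom a η‖ ^ 2 =
        (∫ z, (‖s z‖ ^ 2 : ℝ) * fiberState α z (star a * a) ∂μ).re := by
  -- Trigonometric polynomials approximate s; by `norm_trigVec` their vectors form a Cauchy
  -- sequence, and both sides of the identity pass to the limit.
  obtain ⟨f, hf, hlim⟩ := mem_closure_iff_seq_limit.mp (denseRange_toLp_trigPoly μ s)
  choose c hc using hf
  have hsub : ∀ k l, trigVec α μ (c k) - trigVec α μ (c l) = trigVec α μ (c k - c l) := by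
    intro k l
    simp only [trigVec, map_sub, sub_apply]
  have hcauchy : CauchySeq fun k => trigVec α μ (c k) := by
    rw [Metric.cauchySeq_iff]
    intro ε hε
    obtain ⟨N, hN⟩ := Metric.cauchySeq_iff.mp hlim.cauchySeq ε hε
    refine ⟨N, fun k hk l hl => ?_⟩
    have := hN k hk l hl
    rw [dist_eq_norm, hsub, norm_trigVec, map_sub, map_sub]
    rwa [← hc k, ← hc l, dist_eq_norm] at this
  obtain ⟨η, hη⟩ := cauchySeq_tendsto_of_complete hcauchy
  refine ⟨η, mem_closure_of_tendsto hη (Filter.Eventually.of_forall fun k => ⟨_, rfl⟩),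
    fun a => ?_⟩
  have h1 : Filter.Tendsto (fun k => ‖(state α μ).gnsStarAlgHom a (trigVec α μ (c k))‖ ^ 2)
      Filter.atTop (nhds (‖(state α μ).gnsStarAlgHom a η‖ ^ 2)) :=
    (((((state α μ).gnsStarAlgHom a).continuous.tendsto η).comp hη).norm).pow 2
  have h2 := (Complex.continuous_re.comp (continuous_integral_normSq_mul μ
    ⟨fun z => fiberState α z (star a * a), continuous_fiberState α _⟩)).tendsto s |>.comp hlim
  refine tendsto_nhds_unique h1 (h2.congr fun k => ?_)
  rw [norm_gns_trigVec_sq, Function.comp_apply, ← hc k]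
  rfl

/-- The density of an absolutely continuous measure, as the square of an `L²` function. -/
theorem exists_Lp_sqrt_density {ν : MeasureTheory.Measure Circle}
    [MeasureTheory.IsFiniteMeasure ν] (hν : ν.AbsolutelyContinuous μ) :
    ∃ s : MeasureTheory.Lp ℂ 2 μ, ∀ G : Circle → ℂ,
      ∫ z, (‖s z‖ ^ 2 : ℝ) * G z ∂μ = ∫ z, G z ∂ν := by
  let r : Circle → ℂ := fun z => ((Real.sqrt (ν.rnDeriv μ z).toReal : ℝ) : ℂ)
  have hr : ∀ z, ‖r z‖ ^ 2 = (ν.rnDeriv μ z).toReal := fun z => by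
    rw [Complex.norm_real, Real.norm_of_nonneg (Real.sqrt_nonneg _),
      Real.sq_sqrt ENNReal.toReal_nonneg]
  have hmeas : Measurable r := Complex.measurable_ofReal.comp
    (Real.continuous_sqrt.measurable.comp (MeasureTheory.Measure.measurable_rnDeriv ν μ).ennreal_toReal)
  have hmem : MeasureTheory.MemLp r 2 μ := by
    rw [MeasureTheory.memLp_two_iff_integrable_sq_norm hmeas.aestronglyMeasurable]
    simp only [hr]
    exact MeasureTheory.Measure.integrable_toReal_rnDeriv
  refine ⟨hmem.toLp, fun G => ?_⟩
  rw [← MeasureTheory.integral_rnDeriv_smul hν]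
  refine MeasureTheory.integral_congr_ae ?_
  filter_upwards [hmem.coeFn_toLp] with z hz
  rw [hz, hr]
  rfl

/-- The cyclic vector of `ω_μ` is separating for the bicommutant if the measures `μ ∘ R^{2n}` are
absolutely continuous with respect to `μ`. -/
theorem gnsVector_separating
    (hμ : ∀ n : ℤ, (μ.comap (circleRotation α ^ (2 * n) : Circle ≃ₜ Circle)).AbsolutelyContinuous μ)
    {T : (state α μ).GNS →L[ℂ] (state α μ).GNS} (hT : T ∈ gnsBicommutant (state α μ))
    (hξ : T (gnsVector (state α μ)) = 0) : T = 0 := by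
  -- For n = 0 the rotation is trivial, so π(W(m,0))ξ and ξ define the same functional.
  have hmono : ∀ m : ℤ,
      T ((state α μ).gnsStarAlgHom (weyl α (m, 0)) (gnsVector (state α μ))) = 0 := by
    intro m
    refine apply_eq_zero_of_norm_eq (state α μ).gnsStarAlgHom (fun a => ?_) hT hξ
    rw [← sq_eq_sq₀ (norm_nonneg _) (norm_nonneg _), norm_gns_mul_sq, norm_gns_apply_sq,
      state_weyl_conj, state_eq_integral]
    simp
  have htrig : ∀ c, T (trigVec α μ c) = 0 := by
    intro c
    rw [trigVec, trigElem, Finsupp.linearCombination_apply, Finsupp.sum, map_sum, sum_apply, map_sum]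
    refine Finset.sum_eq_zero fun m _ => ?_
    rw [map_smul, smul_apply, map_smul, hmono, smul_zero]
  have hclosure : ∀ η ∈ closure (Set.range (trigVec α μ)), T η = 0 := by
    intro η hη
    refine closure_minimal (t := {η | T η = 0}) ?_ (isClosed_eq T.continuous continuous_const) hη
    rintro _ ⟨c, rfl⟩
    exact htrig c
  have hweyl : ∀ a : ℤ × ℤ,
      T ((state α μ).gnsStarAlgHom (weyl α a) (gnsVector (state α μ))) = 0 := by
    rintro ⟨m, n⟩
    -- The sign: `comap` along R^{-2n} is the push-forward along R^{2n}, the rotation by 4παn that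
    -- W(m,n) produces.
    let e : Circle ≃ₜ Circle := circleRotation α ^ (2 * -n)
    have he : ∀ z, e.symm z = Circle.exp (4 * Real.pi * α * n) * z := by
      intro z
      have : e.symm = circleRotation α ^ (2 * n) := by
        change (circleRotation α ^ (2 * -n))⁻¹ = _
        rw [← zpow_neg]
        congr 1
        ring
      rw [this, circleRotation_zpow_apply]
      congr 2
      push_cast
      ring
    have hmap : (μ.map e.symm).AbsolutelyContinuous μ := by
      have := hμ (-n)
      rwa [show μ.comap (circleRotation α ^ (2 * -n) : Circle ≃ₜ Circle) = μ.map e.symm from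
        (MeasurableEquiv.map_symm (μ := μ) e.toMeasurableEquiv).symm] at this
    have : MeasureTheory.IsFiniteMeasure (μ.map e.symm) :=
      MeasureTheory.Measure.isFiniteMeasure_map μ _
    -- The root s of the density yields η in the copy of L²(μ) with the same functional as
    -- π(W(m,n))ξ.
    obtain ⟨s, hs⟩ := exists_Lp_sqrt_density μ hmap
    obtain ⟨η, hη, hη'⟩ := exists_vector_of_Lp α μ s
    refine apply_eq_zero_of_norm_eq (state α μ).gnsStarAlgHom (fun a => ?_) hT (hclosure η hη)
    rw [← sq_eq_sq₀ (norm_nonneg _) (norm_nonneg _), norm_gns_mul_sq, hη', hs, state_weyl_conj,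
      e.symm.measurableEmbedding.integral_map]
    simp only [he]
  refine gns_ext fun a => ?_
  -- The map a ↦ Tπ(a)ξ is continuous and vanishes on Weyl elements, whose span is dense.
  let S : NCTorus α →L[ℂ] (state α μ).GNS := LinearMap.mkContinuous
    { toFun := fun a => T ((state α μ).gnsStarAlgHom a (gnsVector (state α μ)))
      map_add' := fun a b => by simp only [map_add, add_apply]
      map_smul' := fun r a => by simp only [map_smul, smul_apply, RingHom.id_apply] }
    (‖T‖ * ‖gnsVector (state α μ)‖) fun a => by
      refine (T.le_opNorm _).trans ?_
      rw [mul_assoc]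
      gcongr
      refine (ContinuousLinearMap.le_opNorm _ _).trans ?_
      rw [mul_comm]
      gcongr
      exact NonUnitalStarAlgHom.norm_apply_le _ _
  have hS : S = 0 := ext_weyl α hweyl
  exact DFunLike.congr_fun hS a

end NCTorus

end

theorem mainTheorem8 (α : ℝ) (hα : Irrational α)
    (μ : MeasureTheory.Measure Circle) [MeasureTheory.IsProbabilityMeasure μ]
    (hμ : ∀ n : ℤ, (μ.comap (circleRotation α ^ (2 * n) : Circle ≃ₜ Circle)).AbsolutelyContinuous μ) :
    (∃ p : Bidual (NCTorus α), Bidual.IsSupport (NCTorus.state α μ) p ∧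
      ∀ F : Bidual (NCTorus α), p * F = F * p) ∧
    (∀ T ∈ gnsBicommutant (NCTorus.state α μ), T (gnsVector (NCTorus.state α μ)) = 0 → T = 0) := by
  have hsep : ∀ T ∈ gnsBicommutant (NCTorus.state α μ),
      T (gnsVector (NCTorus.state α μ)) = 0 → T = 0 :=
    fun T hT hξ => NCTorus.gnsVector_separating α μ hμ hT hξ
  exact ⟨⟨centralProj (NCTorus.state α μ), isSupport_centralProj _ hsep, centralProj_mul_comm _⟩,
    hsep⟩
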